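/- **Proposition (Duality).** All Hilbert spaces are complex and finite-dimensional. Let $f:(0,\infty)\to\mathbb{R}$ be operator anti-monotone, i.e. $0<A\leq B$ implies $f(B)\leq f(A)$ for all positive definite operators $A,B$ on a common finite-dimensional space. For positive semi-definite operators $X,Y$ on a space $\mathcal{H}_S$ with a fixed orthonormal basis $\{|i\rangle\}_i$, define the optimized $f$-divergence $$\widetilde{Q}_f(X\Vert Y)=\sup_{\tau>0,\ \operatorname{Tr}\tau\leq 1,\ \varepsilon>0}\ \langle\varphi^X|\,f\!\left(\tau^{-1}\otimes (Y+\varepsilon\,\Pi_Y^{\perp})^{T}\right)|\varphi^X\rangle\ \in(-\infty,+\infty],\qquad |\varphi^X\rangle=(X^{1/2}\otimes I)\sum_i|i\rangle|i\rangle ,$$ where $\Pi_Y^\perp$ is the orthogonal projection onto $\ker Y$ and $T$ is the transpose in the fixed basis. For a density operator $\rho_{AB}$ on $\mathcal{H}_A\otimes\mathcal{H}_B$ define the optimized conditional $f$-entropy $$\widetilde{S}_f(A|B)_\rho=-\inf_{\sigma_B}\widetilde{Q}_f(\rho_{AB}\Vert I_A\otimes\sigma_B),$$ the infimum being over all density operators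 $\sigma_B$ on $\mathcal{H}_B$. Let $|\psi\rangle$ be a unit vector in $\mathcal{H}_A\otimes\mathcal{H}_B\otimes\mathcal{H}_C$ and let $\psi_{AB}$ and $\psi_{AC}$ be the partial traces of $|\psi\rangle\langle\psi|$ over $C$ and over $B$. Then $$\widetilde{S}_f(A|B)_{\psi}=-\widetilde{S}_k(A|C)_{\psi},\qquad k(x)=-f(1/x)\quad(x>0),$$ where $\widetilde{S}_f(A|B)_{\psi}$ and $\widetilde{S}_k(A|C)_{\psi}$ are evaluated at $\psi_{AB}$ and $\psi_{AC}$, respectively. -/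

import Mathlib

open scoped Matrix Kronecker ComplexOrder

noncomputable section

namespace OptFDiv

/-- `f` is operator anti-monotone on `(0, ∞)`: for positive definite complex matrices
`A ≤ B` (of any size), `f(B) ≤ f(A)`. Only the values of `f` on `(0, ∞)` matter. -/
def OperatorAntiMonotone (f : ℝ → ℝ) : Prop :=
  ∀ (n : ℕ) (A B : Matrix (Fin n) (Fin n) ℂ), A.PosDef → B.PosDef →
    (B - A).PosSemidef → (cfc f A - cfc f B).PosSemidef

section Divergence

variable {s : Type*} [Fintype s] [DecidableEq s]

/-- The unnormalized maximally entangled vector `∑ i, |i⟩|i⟩`. -/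
def gammaVec (s : Type*) [DecidableEq s] : s × s → ℂ :=
  fun p => if p.1 = p.2 then 1 else 0

/-- The vector `|φ^X⟩ = (X^{1/2} ⊗ I)|Γ⟩`. -/
def phiVec (X : Matrix s s ℂ) : s × s → ℂ :=
  (cfc Real.sqrt X ⊗ₖ (1 : Matrix s s ℂ)) *ᵥ gammaVec s

/-- The number `⟨φ^X| f(τ⁻¹ ⊗ Zᵀ) |φ^X⟩`, for positive definite `Z` and `τ`
(it is then real, so that taking the real part changes nothing). -/
def divAt (f : ℝ → ℝ) (X Z τ : Matrix s s ℂ) : ℝ :=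
  (star (phiVec X) ⬝ᵥ (cfc f (τ⁻¹ ⊗ₖ Zᵀ) *ᵥ phiVec X)).re

/-- The orthogonal projection onto the kernel of a Hermitian `Y`, as the spectral projection
of `Y` at the eigenvalue `0`. -/
def kerProj (Y : Matrix s s ℂ) : Matrix s s ℂ :=
  cfc (fun x : ℝ => if x = 0 then 1 else 0) Y

/-- The optimized quantum `f`-divergence of positive semi-definite `X` and `Y`:
the supremum of `divAt f X (Y + ε • kerProj Y) τ` over all `τ > 0` with `Tr τ ≤ 1` and all
`ε > 0`, in the extended reals. -/
def optDiv (f : ℝ → ℝ) (X Y : Matrix s s ℂ) : EReal :=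
  ⨆ (τ : Matrix s s ℂ) (_ : τ.PosDef) (_ : τ.trace ≤ 1) (ε : ℝ) (_ : 0 < ε),
    (divAt f X (Y + (ε : ℂ) • kerProj Y) τ : EReal)

end Divergence

/-- `σ` is a density operator. -/
def IsDensity {s : Type*} [Fintype s] (σ : Matrix s s ℂ) : Prop :=
  σ.PosSemidef ∧ σ.trace = 1

section Entropy

variable {a b : Type*} [Fintype a] [DecidableEq a] [Fintype b] [DecidableEq b]

/-- The optimized conditional `f`-entropy `S_f(A|B)` of a state on `A ⊗ B`:
minus the infimum of `optDiv f ρ (I ⊗ σ)` over the density operators `σ` on `B`. -/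
def condEntropy (f : ℝ → ℝ) (ρ : Matrix (a × b) (a × b) ℂ) : EReal :=
  -⨅ (σ : Matrix b b ℂ) (_ : IsDensity σ), optDiv f ρ ((1 : Matrix a a ℂ) ⊗ₖ σ)

end Entropy

section PureStates

variable {a b c : Type*}

/-- The operator `|ψ⟩⟨ψ|`. -/
def pureState {s : Type*} (ψ : EuclideanSpace ℂ s) : Matrix s s ℂ :=
  Matrix.of fun i j => ψ i * star (ψ j)

/-- Partial trace over the third system of an operator on `A ⊗ B ⊗ C`. -/
def traceThird [Fintype c] (M : Matrix (a × b × c) (a × b × c) ℂ) :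
    Matrix (a × b) (a × b) ℂ :=
  Matrix.of fun i j => ∑ k : c, M (i.1, i.2, k) (j.1, j.2, k)

/-- Partial trace over the second system of an operator on `A ⊗ B ⊗ C`. -/
def traceSecond [Fintype b] (M : Matrix (a × b × c) (a × b × c) ℂ) :
    Matrix (a × c) (a × c) ℂ :=
  Matrix.of fun i j => ∑ k : b, M (i.1, k, i.2) (j.1, k, j.2)

end PureStates

end OptFDiv

end

namespace OptFDiv

set_option linter.unusedSectionVars false

open Matrix
open scoped MatrixOrder

/-! ### Functional calculus of Hermitian matrices through intertwiners. -/

section FunctionalCalculus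

variable {m n : Type*} [Fintype m] [DecidableEq m] [Fintype n] [DecidableEq n]

/-! Write `ψ_AB = Nᴴ * N`, where `N` is the conjugate of `ψ` read as a matrix from `A ⊗ B` to `C`.
The vector `φ^X` for `X = ψ_AB` and the vector `v` of entries of `N` purify the same operator, so a
partial isometry on the purifying system relates them, and the supremum over `τ` may be taken on `C`
(`iSup_divForm_phiVec`). The kernel regularization and the normalization of `σ` can be absorbed as
well (`iInf_density_condForm`). Hence `-S_f(A|B)` is `inf_σ sup_τ F(σ, τ)` with `F(σ, τ) = ⟨v| f(τ⁻¹
⊗ I ⊗ σ) |v⟩`, over positive definite matrices of trace at most one.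

Inverting the argument and exchanging `B` with `C` turns the form of `k` into `-F`
(`condForm_swap`), so `S_k(A|C) = sup_τ inf_σ F(σ, τ)`. Duality is therefore the minimax equality
`condForm_minimax`, an instance of Sion's theorem.

Its hypotheses come from anti-monotonicity alone. A pinching inequality and an intertwiner give a
Jensen inequality with small loss (`divForm_partialIsometry_le`). Applied to a direct sum it yields
concavity in `τ`, first with a loss factor; the scalar case then gives continuity of `f`, which
removes the loss. Convexity in `σ` is concavity for `k`, which is again operator anti-monotone.
Since invertible matrices are not compact, Sion's theorem is applied to `σ` mixed with a fixed
multiple of the identity, and convexity bounds the error uniformly in `τ`. -/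

theorem finite_spectrum_real {A : Matrix n n ℂ} (hA : A.IsHermitian) : (spectrum ℝ A).Finite := by
  rw [hA.spectrum_real_eq_range_eigenvalues]
  exact Set.finite_range _

theorem continuousOn_spectrum {A : Matrix n n ℂ} (hA : A.IsHermitian) (f : ℝ → ℝ) :
    ContinuousOn f (spectrum ℝ A) :=
  (finite_spectrum_real hA).continuousOn f

/-- A unitary diagonalization of a Hermitian matrix, together with its functional calculus. -/
theorem exists_diagonalization {A : Matrix n n ℂ} (hA : A.IsHermitian) :
    ∃ U : Matrix n n ℂ, Uᴴ * U = 1 ∧ U * Uᴴ = 1 ∧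
      A = U * diagonal (fun i => (hA.eigenvalues i : ℂ)) * Uᴴ ∧
      ∀ f : ℝ → ℝ, cfc f A = U * diagonal (fun i => (f (hA.eigenvalues i) : ℂ)) * Uᴴ := by
  refine ⟨hA.eigenvectorUnitary, ?_, ?_, ?_, fun f => ?_⟩
  · simpa [star_eq_conjTranspose] using Unitary.coe_star_mul_self hA.eigenvectorUnitary
  · simpa [star_eq_conjTranspose] using Unitary.coe_mul_star_self hA.eigenvectorUnitary
  · conv_lhs => rw [hA.spectral_theorem]
    rfl
  · rw [hA.cfc_eq]
    rfl

/-- Entrywise, `V i j ≠ 0` forces `d i = e j`, so no regularity of `f` is needed. -/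
theorem diagonal_intertwine (f : ℝ → ℝ) {d : m → ℝ} {e : n → ℝ} {V : Matrix m n ℂ}
    (h : diagonal (fun i => (d i : ℂ)) * V = V * diagonal (fun j => (e j : ℂ))) :
    diagonal (fun i => (f (d i) : ℂ)) * V = V * diagonal (fun j => (f (e j) : ℂ)) := by
  ext i j
  have hij := congrFun (congrFun h i) j
  simp only [diagonal_mul, mul_diagonal] at hij ⊢
  by_cases hV : V i j = 0
  · simp [hV]
  · rw [mul_comm] at hij
    have : d i = e j := by exact_mod_cast mul_left_cancel₀ hV hij
    rw [this, mul_comm]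

/-- The functional calculus respects intertwining operators. -/
theorem cfc_intertwine (f : ℝ → ℝ) {A : Matrix m m ℂ} {B : Matrix n n ℂ} (hA : A.IsHermitian)
    (hB : B.IsHermitian) {V : Matrix m n ℂ} (h : A * V = V * B) :
    cfc f A * V = V * cfc f B := by
  obtain ⟨U, hU, hU', hAU, hfA⟩ := exists_diagonalization hA
  obtain ⟨W, hW, hW', hBW, hfB⟩ := exists_diagonalization hB
  have key : diagonal (fun i => (hA.eigenvalues i : ℂ)) * (Uᴴ * V * W) =
      (Uᴴ * V * W) * diagonal (fun j => (hB.eigenvalues j : ℂ)) := by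
    have := congrArg (fun M => Uᴴ * M * W) h
    rw [hAU, hBW] at this
    calc _ = (Uᴴ * U) * diagonal (fun i => (hA.eigenvalues i : ℂ)) * Uᴴ * V * W := by
            rw [hU, one_mul]; simp only [Matrix.mul_assoc]
      _ = Uᴴ * (V * (W * diagonal (fun j => (hB.eigenvalues j : ℂ)) * Wᴴ)) * W := by
            rw [← this]; simp only [Matrix.mul_assoc]
      _ = Uᴴ * V * W * diagonal (fun j => (hB.eigenvalues j : ℂ)) * (Wᴴ * W) := by
            simp only [Matrix.mul_assoc]
      _ = _ := by rw [hW, Matrix.mul_one]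
  have key' := diagonal_intertwine f key
  rw [hfA, hfB]
  calc _ = U * (diagonal (fun i => (f (hA.eigenvalues i) : ℂ)) * (Uᴴ * V * W)) * Wᴴ := by
        simp only [Matrix.mul_assoc]; rw [hW', Matrix.mul_one]
    _ = (U * Uᴴ) * V * (W * diagonal (fun j => (f (hB.eigenvalues j) : ℂ)) * Wᴴ) := by
        rw [key']; simp only [Matrix.mul_assoc]
    _ = _ := by rw [hU', Matrix.one_mul]

theorem cfc_submatrix (f : ℝ → ℝ) {A : Matrix n n ℂ} (hA : A.IsHermitian) (e : m ≃ n) :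
    cfc f (A.submatrix e e) = (cfc f A).submatrix e e := by
  have hV : ∀ B : Matrix n n ℂ, B * (1 : Matrix n n ℂ).submatrix id e = B.submatrix id e := by
    intro B
    ext i j
    simp [Matrix.mul_apply, Matrix.one_apply]
  have hV' : ∀ C : Matrix m m ℂ, (1 : Matrix n n ℂ).submatrix id e * C = C.submatrix e.symm id := by
    intro C
    ext i j
    simp [Matrix.mul_apply, Matrix.one_apply, ← Equiv.symm_apply_eq]
  -- The intertwiner is the permutation matrix of `e`.
  have := cfc_intertwine f hA (hA.submatrix e) (V := (1 : Matrix n n ℂ).submatrix id e) (by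
    rw [hV, hV']; ext i j; simp)
  rw [hV, hV'] at this
  ext i j
  have h := congrFun (congrFun this (e i)) j
  simpa using h.symm

theorem cfc_diagonal (f : ℝ → ℝ) (d : n → ℝ) :
    cfc f (diagonal (fun i => (d i : ℂ))) = diagonal (fun i => (f (d i) : ℂ)) := by
  have hD : (diagonal (fun i => (d i : ℂ))).IsHermitian := by
    rw [IsHermitian, diagonal_conjTranspose]; congr 1; ext i; simp
  obtain ⟨U, hU, hU', hDU, hf⟩ := exists_diagonalization hD
  have h : diagonal (fun i => (d i : ℂ)) * U =
      U * diagonal (fun i => (hD.eigenvalues i : ℂ)) := by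
    conv_lhs => rw [hDU]
    rw [Matrix.mul_assoc, hU, Matrix.mul_one]
  rw [hf, ← diagonal_intertwine f h, Matrix.mul_assoc, hU', Matrix.mul_one]

theorem cfc_one_kronecker (f : ℝ → ℝ) {A : Matrix n n ℂ} (hA : A.IsHermitian) :
    cfc f ((1 : Matrix m m ℂ) ⊗ₖ A) = 1 ⊗ₖ cfc f A := by
  obtain ⟨U, hU, hU', hAU, hf⟩ := exists_diagonalization hA
  have hd : ∀ g : n → ℂ, (1 : Matrix m m ℂ) ⊗ₖ diagonal g = diagonal fun p => g p.2 := by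
    intro g
    rw [← diagonal_one, diagonal_kronecker_diagonal]
    simp
  have hH : ((1 : Matrix m m ℂ) ⊗ₖ A).IsHermitian := by
    rw [IsHermitian, conjTranspose_kronecker, hA.eq, conjTranspose_one]
  have hD : (diagonal (fun p : m × n => ((hA.eigenvalues p.2 : ℝ) : ℂ))).IsHermitian := by
    rw [IsHermitian, diagonal_conjTranspose]; congr 1; ext i; simp
  have h := cfc_intertwine f hH hD (V := 1 ⊗ₖ U) (by
    rw [← hd (fun i => (hA.eigenvalues i : ℂ)), ← mul_kronecker_mul, ← mul_kronecker_mul]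
    congr 1
    conv_lhs => rw [hAU]
    rw [Matrix.mul_assoc, hU, Matrix.mul_one])
  rw [cfc_diagonal f (fun p : m × n => hA.eigenvalues p.2)] at h
  have h1 := congrArg (· * ((1 : Matrix m m ℂ) ⊗ₖ Uᴴ)) h
  simp only at h1
  rw [Matrix.mul_assoc, ← mul_kronecker_mul, hU', Matrix.mul_one, one_kronecker_one,
    Matrix.mul_one] at h1
  rw [h1, hf, ← hd (fun i => (f (hA.eigenvalues i) : ℂ)), ← mul_kronecker_mul,
    ← mul_kronecker_mul, Matrix.mul_one, Matrix.mul_one]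

theorem cfc_inv_eq (f : ℝ → ℝ) {A : Matrix n n ℂ} (hA : A.PosDef) :
    cfc f A⁻¹ = cfc (fun x => f x⁻¹) A := by
  have hu := hA.isUnit
  have hs := finite_spectrum_real hA.isHermitian
  have h := cfc_comp_inv f hu.unit ((hs.image _).continuousOn f) hA.isHermitian
  rw [IsUnit.unit_spec] at h
  rw [h, Matrix.coe_units_inv, IsUnit.unit_spec]

theorem isHermitian_cfc (f : ℝ → ℝ) (A : Matrix n n ℂ) : (cfc f A).IsHermitian :=
  cfc_predicate f A

/-- The quadratic form of a matrix. -/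
noncomputable def quadForm (v : n → ℂ) (A : Matrix n n ℂ) : ℝ := (star v ⬝ᵥ (A *ᵥ v)).re

theorem quadForm_add (v : n → ℂ) (A B : Matrix n n ℂ) :
    quadForm v (A + B) = quadForm v A + quadForm v B := by
  simp [quadForm, add_mulVec, dotProduct_add]

theorem quadForm_neg (v : n → ℂ) (A : Matrix n n ℂ) : quadForm v (-A) = -quadForm v A := by
  simp [quadForm, neg_mulVec, dotProduct_neg]

theorem quadForm_smul (v : n → ℂ) (r : ℝ) (A : Matrix n n ℂ) :
    quadForm v ((r : ℂ) • A) = r * quadForm v A := by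
  simp [quadForm, smul_mulVec, dotProduct_smul]

theorem quadForm_mono (v : n → ℂ) {A B : Matrix n n ℂ} (h : A ≤ B) :
    quadForm v A ≤ quadForm v B := by
  have := PosSemidef.re_dotProduct_nonneg (le_iff.mp h) v
  simp only [sub_mulVec, dotProduct_sub, map_sub] at this
  simpa [quadForm] using this

theorem quadForm_mulVec (V : Matrix m n ℂ) (x : n → ℂ) (A : Matrix m m ℂ) :
    quadForm (V *ᵥ x) A = quadForm x (Vᴴ * A * V) := by
  simp only [quadForm, star_mulVec, ← dotProduct_mulVec, mulVec_mulVec]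
  simp [Matrix.mul_assoc]

theorem quadForm_submatrix (e : m ≃ n) (v : n → ℂ) (A : Matrix n n ℂ) :
    quadForm (v ∘ e) (A.submatrix e e) = quadForm v A := by
  rw [quadForm, submatrix_mulVec_equiv, quadForm]
  congr 1
  rw [Function.comp_assoc, Equiv.self_comp_symm, Function.comp_id]
  exact comp_equiv_dotProduct_comp_equiv (star v) _ e

/-- One diagonalization serves all `r`: scaling only multiplies the eigenvalues, leaving a finite
sum of scalar functions of `r`. -/
theorem continuousAt_quadForm_cfc_smul {f : ℝ → ℝ} (hf : ContinuousOn f (Set.Ioi 0)) (v : n → ℂ)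
    {A : Matrix n n ℂ} (hA : A.PosDef) {r : ℝ} (hr : 0 < r) :
    ContinuousAt (fun r : ℝ => quadForm v (cfc f ((r : ℂ) • A))) r := by
  have hs := finite_spectrum_real hA.isHermitian
  have heq : ∀ r : ℝ, cfc f ((r : ℂ) • A) = cfc (fun x => f (r * x)) A := by
    intro r
    exact (cfc_comp_const_mul r f A ((hs.image _).continuousOn f) hA.isHermitian).symm
  obtain ⟨U, hU, hU', hAU, hfA⟩ := exists_diagonalization hA.isHermitian
  have heq' : (fun r : ℝ => quadForm v (cfc f ((r : ℂ) • A))) = fun r : ℝ =>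
      (∑ i, star ((Uᴴ *ᵥ v) i) *
        ((f (r * hA.isHermitian.eigenvalues i) : ℂ) * (Uᴴ *ᵥ v) i)).re := by
    ext r
    rw [heq, hfA]
    have : U * diagonal (fun i => (f (r * hA.isHermitian.eigenvalues i) : ℂ)) * Uᴴ =
      Uᴴᴴ * diagonal (fun i => (f (r * hA.isHermitian.eigenvalues i) : ℂ)) * Uᴴ := by simp
    rw [this, ← quadForm_mulVec, quadForm]
    simp [dotProduct, mulVec_diagonal]
  rw [heq']
  apply Complex.continuous_re.continuousAt.comp
  apply tendsto_finsetSum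
  intro i _
  apply ContinuousAt.mul continuousAt_const
  apply ContinuousAt.mul _ continuousAt_const
  apply Complex.continuous_ofReal.continuousAt.comp
  have hpos : 0 < r * hA.isHermitian.eigenvalues i := mul_pos hr (hA.eigenvalues_pos i)
  have h1 : ContinuousAt f (r * hA.isHermitian.eigenvalues i) :=
    hf.continuousAt (Ioi_mem_nhds hpos)
  exact h1.comp (f := fun r : ℝ => r * hA.isHermitian.eigenvalues i) (by fun_prop)

end FunctionalCalculus

/-! ### The Loewner order. -/

section Order

variable {m n : Type*} [Fintype m] [DecidableEq m] [Fintype n] [DecidableEq n]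

theorem smul_posSemidef {r : ℝ} (hr : 0 ≤ r) {A : Matrix n n ℂ} (hA : A.PosSemidef) :
    ((r : ℂ) • A).PosSemidef := hA.smul (by exact_mod_cast hr)

theorem smul_posDef {r : ℝ} (hr : 0 < r) {A : Matrix n n ℂ} (hA : A.PosDef) :
    ((r : ℂ) • A).PosDef := hA.smul (by exact_mod_cast hr)

theorem smul_mono {r : ℝ} (hr : 0 ≤ r) {A B : Matrix n n ℂ} (h : A ≤ B) :
    (r : ℂ) • A ≤ (r : ℂ) • B := by
  rw [le_iff, ← smul_sub]
  exact smul_posSemidef hr h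

theorem smul_le_smul_of_posSemidef {r t : ℝ} (h : r ≤ t) {A : Matrix n n ℂ} (hA : A.PosSemidef) :
    (r : ℂ) • A ≤ (t : ℂ) • A := by
  rw [le_iff, ← sub_smul, ← Complex.ofReal_sub]
  exact smul_posSemidef (sub_nonneg.mpr h) hA

theorem posDef_of_le {A B : Matrix n n ℂ} (hA : A.PosDef) (h : A ≤ B) : B.PosDef := by
  have := hA.add_posSemidef (le_iff.mp h)
  rwa [add_sub_cancel] at this

theorem conj_mono (V : Matrix m n ℂ) {A B : Matrix m m ℂ} (h : A ≤ B) :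
    Vᴴ * A * V ≤ Vᴴ * B * V := by
  rw [le_iff, ← Matrix.sub_mul, ← Matrix.mul_sub]
  exact (le_iff.mp h).conjTranspose_mul_mul_same V

theorem kronecker_mono_left {A B : Matrix m m ℂ} {C : Matrix n n ℂ} (h : A ≤ B)
    (hC : C.PosSemidef) : A ⊗ₖ C ≤ B ⊗ₖ C := by
  have := (le_iff.mp h).kronecker hC
  rw [le_iff]
  convert this using 1
  ext i j
  simp [sub_mul]

theorem kronecker_mono_right {A B : Matrix m m ℂ} {C : Matrix n n ℂ} (h : A ≤ B)
    (hC : C.PosSemidef) : C ⊗ₖ A ≤ C ⊗ₖ B := by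
  have := hC.kronecker (le_iff.mp h)
  rw [le_iff]
  convert this using 1
  ext i j
  simp [mul_sub]

/-- Inversion is operator anti-monotone. -/
theorem inv_antitone {A B : Matrix n n ℂ} (hA : A.PosDef) (h : A ≤ B) : B⁻¹ ≤ A⁻¹ := by
  have hB := posDef_of_le hA h
  let := hB.isUnit.invertible
  let := hA.inv.isUnit.invertible
  have hAu := (isUnit_iff_isUnit_det A).mp hA.isUnit
  -- The block matrix with diagonal `B`, `A⁻¹` and off-diagonal identities has the Schur complements
  -- `B - A` and `A⁻¹ - B⁻¹`; either one decides its positivity.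
  have h1 := PosDef.fromBlocks₂₂ B (1 : Matrix n n ℂ) hA.inv
  have h2 := PosDef.fromBlocks₁₁ (1 : Matrix n n ℂ) A⁻¹ hB
  rw [Matrix.nonsing_inv_nonsing_inv A hAu] at h1
  simp only [conjTranspose_one, Matrix.mul_one, Matrix.one_mul] at h1 h2
  exact h2.mp (h1.mpr h)

theorem exists_smul_one_le {A : Matrix n n ℂ} (hA : A.PosDef) :
    ∃ r : ℝ, 0 < r ∧ (r : ℂ) • (1 : Matrix n n ℂ) ≤ A := by
  obtain ⟨U, hU, hU', hAU, -⟩ := exists_diagonalization hA.isHermitian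
  obtain ⟨r, hr, hle⟩ : ∃ r : ℝ, 0 < r ∧ ∀ i, r ≤ hA.isHermitian.eigenvalues i := by
    rcases isEmpty_or_nonempty n with h | h
    · exact ⟨1, one_pos, fun i => h.elim i⟩
    · obtain ⟨i, hi⟩ := Finite.exists_min hA.isHermitian.eigenvalues
      exact ⟨_, hA.eigenvalues_pos i, hi⟩
  refine ⟨r, hr, ?_⟩
  have : A - (r : ℂ) • 1 =
      U * diagonal (fun i => ((hA.isHermitian.eigenvalues i - r : ℝ) : ℂ)) * Uᴴ := by
    have : diagonal (fun i => ((hA.isHermitian.eigenvalues i - r : ℝ) : ℂ)) =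
      diagonal (fun i => (hA.isHermitian.eigenvalues i : ℂ)) - (r : ℂ) • 1 := by
      rw [smul_one_eq_diagonal, diagonal_sub]; congr 1; ext i; simp
    rw [this, Matrix.mul_sub, Matrix.sub_mul, ← hAU]
    simp [hU']
  rw [le_iff, this]
  apply PosSemidef.mul_mul_conjTranspose_same
  apply PosSemidef.diagonal
  intro i
  simpa using hle i

theorem le_trace_smul_one {A : Matrix n n ℂ} (hA : A.PosSemidef) :
    A ≤ ((A.trace.re : ℝ) : ℂ) • (1 : Matrix n n ℂ) := by
  obtain ⟨U, hU, hU', hAU, -⟩ := exists_diagonalization hA.isHermitian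
  have htr : A.trace.re = ∑ i, hA.isHermitian.eigenvalues i := by
    rw [hA.isHermitian.trace_eq_sum_eigenvalues]
    simp
  have : ((A.trace.re : ℝ) : ℂ) • 1 - A =
      U * diagonal (fun i => ((A.trace.re - hA.isHermitian.eigenvalues i : ℝ) : ℂ)) * Uᴴ := by
    have : diagonal (fun i => ((A.trace.re - hA.isHermitian.eigenvalues i : ℝ) : ℂ)) =
      (A.trace.re : ℂ) • 1 - diagonal (fun i => (hA.isHermitian.eigenvalues i : ℂ)) := by
      rw [smul_one_eq_diagonal, diagonal_sub]; congr 1; ext i; simp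
    rw [this, Matrix.mul_sub, Matrix.sub_mul, ← hAU]
    simp [hU']
  rw [le_iff, this]
  apply PosSemidef.mul_mul_conjTranspose_same
  apply PosSemidef.diagonal
  intro i
  have := Finset.single_le_sum (fun j _ => hA.eigenvalues_nonneg j) (Finset.mem_univ i)
  rw [← htr] at this
  simpa using this

theorem le_one_of_trace_le_one {A : Matrix n n ℂ} (hA : A.PosSemidef) (h : A.trace ≤ 1) :
    A ≤ 1 := by
  refine (le_trace_smul_one hA).trans ?_
  have := smul_le_smul_of_posSemidef (n := n) (Complex.le_def.mp h).1 PosSemidef.one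
  simpa using this

theorem trace_im_eq_zero {A : Matrix n n ℂ} (hA : A.IsHermitian) : A.trace.im = 0 := by
  have := congrArg trace hA.eq
  rw [trace_conjTranspose] at this
  exact Complex.conj_eq_iff_im.mp this

theorem trace_le_one_iff {A : Matrix n n ℂ} (hA : A.IsHermitian) : A.trace ≤ 1 ↔ A.trace.re ≤ 1 := by
  simp [Complex.le_def, trace_im_eq_zero hA]

/-- Every matrix is below the sum of the norms of its entries. -/
theorem le_sum_norm_smul_one {A : Matrix n n ℂ} (hA : A.IsHermitian) :
    A ≤ ((∑ i, ∑ j, ‖A i j‖ : ℝ) : ℂ) • (1 : Matrix n n ℂ) := by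
  rw [le_iff]
  refine .of_dotProduct_mulVec_nonneg ?_ fun x => ?_
  · apply IsHermitian.sub _ hA
    rw [IsHermitian, conjTranspose_smul, conjTranspose_one]
    simp
  · have him : (star x ⬝ᵥ (A *ᵥ x)).im = 0 := hA.im_star_dotProduct_mulVec_self x
    have hxx : star x ⬝ᵥ x = ((∑ k, ‖x k‖ ^ 2 : ℝ) : ℂ) := by
      simp [dotProduct, Complex.conj_mul']
    have hre : (star x ⬝ᵥ (A *ᵥ x)).re ≤ (∑ i, ∑ j, ‖A i j‖) * ∑ k, ‖x k‖ ^ 2 := by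
      refine (Complex.re_le_norm _).trans ?_
      rw [dotProduct, Finset.sum_mul]
      refine (norm_sum_le _ _).trans (Finset.sum_le_sum fun i _ => ?_)
      rw [norm_mul, Pi.star_apply, norm_star, mulVec, dotProduct, Finset.sum_mul]
      refine (mul_le_mul_of_nonneg_left (norm_sum_le _ _) (norm_nonneg _)).trans ?_
      rw [Finset.mul_sum]
      refine Finset.sum_le_sum fun j _ => ?_
      have h1 : ‖x i‖ ^ 2 ≤ ∑ k, ‖x k‖ ^ 2 :=
        Finset.single_le_sum (f := fun k => ‖x k‖ ^ 2) (fun k _ => by positivity)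
          (Finset.mem_univ i)
      have h2 : ‖x j‖ ^ 2 ≤ ∑ k, ‖x k‖ ^ 2 :=
        Finset.single_le_sum (f := fun k => ‖x k‖ ^ 2) (fun k _ => by positivity)
          (Finset.mem_univ j)
      rw [norm_mul]
      calc ‖x i‖ * (‖A i j‖ * ‖x j‖) = ‖A i j‖ * (‖x i‖ * ‖x j‖) := by ring
        _ ≤ _ := mul_le_mul_of_nonneg_left
          (by nlinarith [sq_nonneg (‖x i‖ - ‖x j‖)]) (norm_nonneg _)
    rw [sub_mulVec, dotProduct_sub, smul_mulVec, one_mulVec, dotProduct_smul, hxx,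
      Complex.le_def]
    simp only [smul_eq_mul, Complex.zero_re, Complex.zero_im, Complex.sub_re, Complex.sub_im,
      ← Complex.ofReal_mul, Complex.ofReal_re, Complex.ofReal_im, him]
    exact ⟨by linarith, by simp⟩

end Order

/-! ### Anti-monotone functions and their duals. -/

section AntiMonotone

variable {m n : Type*} [Fintype m] [DecidableEq m] [Fintype n] [DecidableEq n]

/-- The function `x ↦ -f(1/x)`. -/
noncomputable def dualFun (f : ℝ → ℝ) : ℝ → ℝ := fun x => -f x⁻¹

theorem OperatorAntiMonotone.cfc_le {f : ℝ → ℝ} (hf : OperatorAntiMonotone f) {A B : Matrix n n ℂ}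
    (hA : A.PosDef) (h : A ≤ B) : cfc f B ≤ cfc f A := by
  have hB := posDef_of_le hA h
  let e := (Fintype.equivFin n).symm
  have := hf (Fintype.card n) (A.submatrix e e) (B.submatrix e e) (hA.submatrix e.injective)
    (hB.submatrix e.injective) ((le_iff.mp h).submatrix e)
  rw [cfc_submatrix f hA.isHermitian, cfc_submatrix f hB.isHermitian] at this
  exact (posSemidef_submatrix_equiv e).mp this

theorem cfc_dualFun (f : ℝ → ℝ) {A : Matrix n n ℂ} (hA : A.PosDef) :
    cfc (dualFun f) A = -cfc f A⁻¹ := by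
  rw [cfc_inv_eq f hA, ← cfc_neg]
  rfl

theorem OperatorAntiMonotone.dualFun {f : ℝ → ℝ} (hf : OperatorAntiMonotone f) :
    OperatorAntiMonotone (dualFun f) := by
  intro n A B hA hB h
  rw [cfc_dualFun f hA, cfc_dualFun f hB]
  rw [neg_sub_neg]
  exact le_iff.mp (hf.cfc_le hB.inv (inv_antitone hA h))

end AntiMonotone

/-! ### The quadratic form in `τ` and `Z`: monotonicity, Jensen inequality, concavity. -/

section DivForm

variable {c d s : Type*} [Fintype c] [DecidableEq c] [Fintype d] [DecidableEq d]
  [Fintype s] [DecidableEq s]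

/-- The number `⟨v| f(τ⁻¹ ⊗ Z) |v⟩`. -/
noncomputable def divForm (f : ℝ → ℝ) (v : c × s → ℂ) (τ : Matrix c c ℂ) (Z : Matrix s s ℂ) : ℝ :=
  quadForm v (cfc f (τ⁻¹ ⊗ₖ Z))

theorem divForm_mono_left {f : ℝ → ℝ} (hf : OperatorAntiMonotone f) (v : c × s → ℂ)
    {τ τ' : Matrix c c ℂ} {Z : Matrix s s ℂ} (hτ : τ.PosDef) (hZ : Z.PosDef) (h : τ ≤ τ') :
    divForm f v τ Z ≤ divForm f v τ' Z :=
  quadForm_mono v (hf.cfc_le ((posDef_of_le hτ h).inv.kronecker hZ)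
    (kronecker_mono_left (inv_antitone hτ h) hZ.posSemidef))

theorem divForm_anti_right {f : ℝ → ℝ} (hf : OperatorAntiMonotone f) (v : c × s → ℂ)
    {τ : Matrix c c ℂ} {Z Z' : Matrix s s ℂ} (hτ : τ.PosDef) (hZ : Z.PosDef) (h : Z ≤ Z') :
    divForm f v τ Z' ≤ divForm f v τ Z :=
  quadForm_mono v (hf.cfc_le (hτ.inv.kronecker hZ)
    (kronecker_mono_right h hτ.inv.posSemidef))

theorem inv_intertwine {A : Matrix c c ℂ} {B : Matrix d d ℂ} (hA : A.PosDef) (hB : B.PosDef)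
    {V : Matrix c d ℂ} (h : A * V = V * B) : A⁻¹ * V = V * B⁻¹ := by
  have hAu := (isUnit_iff_isUnit_det A).mp hA.isUnit
  have hBu := (isUnit_iff_isUnit_det B).mp hB.isUnit
  calc A⁻¹ * V = A⁻¹ * (V * B) * B⁻¹ := by
        rw [Matrix.mul_assoc, Matrix.mul_assoc, mul_nonsing_inv _ hBu, Matrix.mul_one]
    _ = V * B⁻¹ := by rw [← h, ← Matrix.mul_assoc, nonsing_inv_mul _ hAu, Matrix.one_mul]

theorem cfc_inv_kronecker_intertwine (f : ℝ → ℝ) {A : Matrix c c ℂ} {B : Matrix d d ℂ}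
    (hA : A.PosDef) (hB : B.PosDef) {V : Matrix c d ℂ} (h : A * V = V * B) {Z : Matrix s s ℂ}
    (hZ : Z.PosDef) :
    (cfc f (A⁻¹ ⊗ₖ Z) : Matrix (c × s) (c × s) ℂ) *
        (V ⊗ₖ (1 : Matrix s s ℂ) : Matrix (c × s) (d × s) ℂ) =
      (V ⊗ₖ (1 : Matrix s s ℂ) : Matrix (c × s) (d × s) ℂ) *
        (cfc f (B⁻¹ ⊗ₖ Z) : Matrix (d × s) (d × s) ℂ) := by
  apply cfc_intertwine f (hA.inv.kronecker hZ).isHermitian (hB.inv.kronecker hZ).isHermitian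
  rw [← mul_kronecker_mul, ← mul_kronecker_mul, inv_intertwine hA hB h, Matrix.mul_one,
    Matrix.one_mul]

/-- Pinching by a projection, with an arbitrarily small multiplicative loss. -/
theorem le_pinching {τ Q : Matrix c c ℂ} (hτ : τ.PosSemidef) (hQ : Qᴴ = Q) {r : ℝ} (hr : 0 < r) :
    τ ≤ ((1 + r : ℝ) : ℂ) • (Q * τ * Q) + ((1 + r⁻¹ : ℝ) : ℂ) • ((1 - Q) * τ * (1 - Q)) := by
  -- Expanding `r⁻¹ (rQ - (1 - Q)) τ (rQ - (1 - Q)) ≥ 0` gives exactly the difference of the two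
  -- sides.
  have h := smul_posSemidef (inv_nonneg.mpr hr.le)
    (hτ.conjTranspose_mul_mul_same ((r : ℂ) • Q - (1 - Q)))
  rw [le_iff]
  refine (congrArg PosSemidef ?_).mp h
  simp only [conjTranspose_sub, conjTranspose_smul, conjTranspose_one, hQ]
  have hr' : (r : ℂ) ≠ 0 := by exact_mod_cast hr.ne'
  have hs : star (r : ℂ) = r := by simp
  rw [hs]
  simp only [Matrix.sub_mul, Matrix.mul_sub, smul_sub, Matrix.smul_mul, Matrix.mul_smul, smul_smul,
    Matrix.one_mul, add_smul, Complex.ofReal_add, Complex.ofReal_one, one_smul,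
    Complex.ofReal_inv, inv_mul_cancel₀ hr', inv_mul_cancel_left₀ hr', mul_one]
  abel

/-- If `τ ≥ l`, the first term dominates `p l` on the support of `V` and the second is `t` on its
complement, so `min (p * l) t` bounds the sum from below. -/
theorem posDef_partialIsometry {V : Matrix c d ℂ} (hV : V * Vᴴ * V = V) {τ : Matrix c c ℂ}
    (hτ : τ.PosDef) {p t : ℝ} (hp : 0 < p) (ht : 0 < t) :
    ((p : ℂ) • (Vᴴ * τ * V) + (t : ℂ) • (1 - Vᴴ * V)).PosDef := by
  have hP : (1 - Vᴴ * V)ᴴ * (1 - Vᴴ * V) = 1 - Vᴴ * V := by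
    have : Vᴴ * V * (Vᴴ * V) = Vᴴ * V := by rw [Matrix.mul_assoc, ← Matrix.mul_assoc V, hV]
    simp [Matrix.sub_mul, Matrix.mul_sub, this]
  have hP' : (1 - Vᴴ * V).PosSemidef := by
    rw [← hP]; exact posSemidef_conjTranspose_mul_self _
  have hVV : (Vᴴ * V).PosSemidef := posSemidef_conjTranspose_mul_self V
  obtain ⟨l, hl, hlτ⟩ := exists_smul_one_le hτ
  have e1 : ((min (p * l) t : ℝ) : ℂ) • (Vᴴ * V) ≤ (p : ℂ) • (Vᴴ * τ * V) := by
    calc ((min (p * l) t : ℝ) : ℂ) • (Vᴴ * V) ≤ ((p * l : ℝ) : ℂ) • (Vᴴ * V) :=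
          smul_le_smul_of_posSemidef (min_le_left _ _) hVV
      _ = (p : ℂ) • (Vᴴ * ((l : ℂ) • (1 : Matrix c c ℂ)) * V) := by
          rw [Matrix.mul_smul, Matrix.mul_one, Matrix.smul_mul, smul_smul, Complex.ofReal_mul]
      _ ≤ _ := smul_mono hp.le (conj_mono V hlτ)
  have e2 := add_le_add e1 (smul_le_smul_of_posSemidef (min_le_right (p * l) t) hP')
  rw [← smul_add, add_sub_cancel] at e2
  exact posDef_of_le (smul_posDef (lt_min (mul_pos hp hl) ht) PosDef.one) e2

/-- Enlarging `τ` to its pinching `B` makes it commute with `Q = V Vᴴ`. Then `V` intertwines `B`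
with the matrix on the right, and so also their functional calculi. The `t` term only provides
invertibility, since `x` lives on the support of `V`. -/
theorem divForm_partialIsometry_le {f : ℝ → ℝ} (hf : OperatorAntiMonotone f) {V : Matrix c d ℂ}
    (hV : V * Vᴴ * V = V) {x : d × s → ℂ} (hx : ((Vᴴ * V) ⊗ₖ (1 : Matrix s s ℂ)) *ᵥ x = x)
    {τ : Matrix c c ℂ} {Z : Matrix s s ℂ} (hτ : τ.PosDef) (hZ : Z.PosDef) {r t : ℝ} (hr : 0 < r)
    (ht : 0 < t) :
    divForm f ((V ⊗ₖ (1 : Matrix s s ℂ)) *ᵥ x) τ Z ≤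
      divForm f x (((1 + r : ℝ) : ℂ) • (Vᴴ * τ * V) + (t : ℂ) • (1 - Vᴴ * V)) Z := by
  set Q := V * Vᴴ with hQdef
  have hQ : Qᴴ = Q := by rw [hQdef, conjTranspose_mul, conjTranspose_conjTranspose]
  have hV' : V * (Vᴴ * V) = V := by rw [← Matrix.mul_assoc, hV]
  set T := ((1 + r : ℝ) : ℂ) • (Vᴴ * τ * V) + (t : ℂ) • (1 - Vᴴ * V) with hT
  set B := ((1 + r : ℝ) : ℂ) • (Q * τ * Q) +
    ((1 + r⁻¹ : ℝ) : ℂ) • ((1 - Q) * τ * (1 - Q)) with hB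
  have hle : τ ≤ B := le_pinching hτ.posSemidef hQ hr
  have hBpos := posDef_of_le hτ hle
  have hTpos : T.PosDef := posDef_partialIsometry hV hτ (by linarith) ht
  have hBV : B * V = V * T := by
    have hQV : Q * V = V := hV
    have h0 : (1 - Q) * V = 0 := by rw [Matrix.sub_mul, hQV, Matrix.one_mul, sub_self]
    rw [hB, hT, Matrix.add_mul, Matrix.mul_add, Matrix.smul_mul, Matrix.smul_mul, Matrix.mul_smul,
      Matrix.mul_smul, Matrix.mul_assoc _ Q V, hQV, Matrix.mul_assoc _ (1 - Q) V, h0,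
      Matrix.mul_sub, hV', hQdef]
    simp [Matrix.mul_assoc]
  have hCV := cfc_inv_kronecker_intertwine f hBpos hTpos hBV hZ
  refine (divForm_mono_left hf _ hτ hZ hle).trans (le_of_eq ?_)
  rw [divForm, quadForm_mulVec, Matrix.mul_assoc, hCV, ← Matrix.mul_assoc, conjTranspose_kronecker,
    ← mul_kronecker_mul, conjTranspose_one, Matrix.mul_one, divForm, quadForm, quadForm,
    ← mulVec_mulVec, dotProduct_mulVec]
  congr 2
  have h2 := congrArg star hx
  rw [star_mulVec, conjTranspose_kronecker] at h2
  simpa using h2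

theorem posDef_fromBlocks {A : Matrix c c ℂ} {B : Matrix d d ℂ} (hA : A.PosDef) (hB : B.PosDef) :
    (fromBlocks A 0 0 B).PosDef := by
  let := hA.isUnit.invertible
  have h := PosDef.fromBlocks₁₁ (0 : Matrix c d ℂ) B hA
  simp only [conjTranspose_zero, Matrix.zero_mul, Matrix.mul_zero, sub_zero] at h
  rw [(h.mpr hB.posSemidef).posDef_iff_isUnit, isUnit_iff_isUnit_det, det_fromBlocks_zero₂₁]
  exact ((isUnit_iff_isUnit_det A).mp hA.isUnit).mul ((isUnit_iff_isUnit_det B).mp hB.isUnit)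

/-- Compress the direct sum `D` of `A` and `B` by the isometry `V = √p I₁ + √q I₂`: `Vᴴ D V` is the
convex combination, while compressing the functional calculus of `D` averages those of `A` and `B`.
-/
theorem divForm_concave_of_slack {f : ℝ → ℝ} (hf : OperatorAntiMonotone f) (v : c × s → ℂ)
    {A B : Matrix c c ℂ} {Z : Matrix s s ℂ} (hA : A.PosDef) (hB : B.PosDef) (hZ : Z.PosDef)
    {p q : ℝ} (hp : 0 ≤ p) (hq : 0 ≤ q) (hpq : p + q = 1) {r : ℝ} (hr : 0 < r) :
    p * divForm f v A Z + q * divForm f v B Z ≤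
      divForm f v (((1 + r : ℝ) : ℂ) • ((p : ℂ) • A + (q : ℂ) • B)) Z := by
  set I₁ : Matrix (c ⊕ c) c ℂ := fromRows 1 0 with hI₁
  set I₂ : Matrix (c ⊕ c) c ℂ := fromRows 0 1 with hI₂
  have hI₁H : I₁ᴴ = fromCols 1 0 := by rw [hI₁, conjTranspose_fromRows_eq_fromCols_conjTranspose]; simp
  have hI₂H : I₂ᴴ = fromCols 0 1 := by rw [hI₂, conjTranspose_fromRows_eq_fromCols_conjTranspose]; simp
  have h11 : I₁ᴴ * I₁ = 1 := by rw [hI₁H, hI₁, fromCols_mul_fromRows]; simp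
  have h12 : I₁ᴴ * I₂ = 0 := by rw [hI₁H, hI₂, fromCols_mul_fromRows]; simp
  have h21 : I₂ᴴ * I₁ = 0 := by rw [hI₂H, hI₁, fromCols_mul_fromRows]; simp
  have h22 : I₂ᴴ * I₂ = 1 := by rw [hI₂H, hI₂, fromCols_mul_fromRows]; simp
  set D := fromBlocks A 0 0 B with hDdef
  have hD : D.PosDef := posDef_fromBlocks hA hB
  have hD1 : D * I₁ = I₁ * A := by rw [hDdef, hI₁, fromBlocks_mul_fromRows, fromRows_mul]; simp
  have hD2 : D * I₂ = I₂ * B := by rw [hDdef, hI₂, fromBlocks_mul_fromRows, fromRows_mul]; simp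
  set V : Matrix (c ⊕ c) c ℂ := ((√p : ℝ) : ℂ) • I₁ + ((√q : ℝ) : ℂ) • I₂ with hVdef
  have hpp : ((√p : ℝ) : ℂ) * ((√p : ℝ) : ℂ) = p := by
    rw [← Complex.ofReal_mul, Real.mul_self_sqrt hp]
  have hqq : ((√q : ℝ) : ℂ) * ((√q : ℝ) : ℂ) = q := by
    rw [← Complex.ofReal_mul, Real.mul_self_sqrt hq]
  have hVH : Vᴴ = ((√p : ℝ) : ℂ) • I₁ᴴ + ((√q : ℝ) : ℂ) • I₂ᴴ := by
    rw [hVdef, conjTranspose_add, conjTranspose_smul, conjTranspose_smul]; simp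
  have hVV : Vᴴ * V = 1 := by
    rw [hVH, hVdef]
    simp only [Matrix.add_mul, Matrix.mul_add, Matrix.smul_mul, Matrix.mul_smul, h11, h12, h21,
      h22, smul_smul, hpp, hqq, smul_zero, add_zero, zero_add]
    rw [← add_smul, ← Complex.ofReal_add, hpq]
    simp
  have hVDV : Vᴴ * D * V = (p : ℂ) • A + (q : ℂ) • B := by
    have : D * V = ((√p : ℝ) : ℂ) • (I₁ * A) + ((√q : ℝ) : ℂ) • (I₂ * B) := by
      rw [hVdef, Matrix.mul_add, Matrix.mul_smul, Matrix.mul_smul, hD1, hD2]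
    rw [Matrix.mul_assoc, this, hVH]
    simp only [Matrix.add_mul, Matrix.mul_add, Matrix.smul_mul, Matrix.mul_smul,
      ← Matrix.mul_assoc, h11, h12, h21, h22, smul_smul, hpp, hqq, smul_zero, add_zero, zero_add,
      Matrix.one_mul]
  have h := divForm_partialIsometry_le hf (V := V) (by rw [Matrix.mul_assoc, hVV, Matrix.mul_one])
    (x := v) (by rw [hVV, one_kronecker_one, one_mulVec]) hD hZ hr one_pos
  rw [hVDV, hVV, sub_self, smul_zero, add_zero] at h
  refine le_trans (le_of_eq ?_) h
  have hC1 := cfc_inv_kronecker_intertwine f hD hA hD1 hZ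
  have hC2 := cfc_inv_kronecker_intertwine f hD hB hD2 hZ
  have hVk : V ⊗ₖ (1 : Matrix s s ℂ) =
      ((√p : ℝ) : ℂ) • (I₁ ⊗ₖ 1) + ((√q : ℝ) : ℂ) • (I₂ ⊗ₖ 1) := by
    rw [hVdef, add_kronecker, smul_kronecker, smul_kronecker]
  have hVkH : (V ⊗ₖ (1 : Matrix s s ℂ))ᴴ =
      ((√p : ℝ) : ℂ) • (I₁ᴴ ⊗ₖ 1) + ((√q : ℝ) : ℂ) • (I₂ᴴ ⊗ₖ 1) := by
    rw [conjTranspose_kronecker, hVH, add_kronecker, smul_kronecker, smul_kronecker,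
      conjTranspose_one]
  rw [divForm, divForm, divForm, quadForm_mulVec]
  generalize cfc f (D⁻¹ ⊗ₖ Z) = CD at hC1 hC2 ⊢
  generalize cfc f (A⁻¹ ⊗ₖ Z) = CA at hC1 ⊢
  generalize cfc f (B⁻¹ ⊗ₖ Z) = CB at hC2 ⊢
  have hfin : (V ⊗ₖ (1 : Matrix s s ℂ) : Matrix ((c ⊕ c) × s) (c × s) ℂ)ᴴ * CD *
      (V ⊗ₖ (1 : Matrix s s ℂ) : Matrix ((c ⊕ c) × s) (c × s) ℂ) = (p : ℂ) • CA + (q : ℂ) • CB := by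
    have : CD * (V ⊗ₖ (1 : Matrix s s ℂ) : Matrix ((c ⊕ c) × s) (c × s) ℂ) =
        ((√p : ℝ) : ℂ) • ((I₁ ⊗ₖ (1 : Matrix s s ℂ) : Matrix ((c ⊕ c) × s) (c × s) ℂ) * CA) +
          ((√q : ℝ) : ℂ) • ((I₂ ⊗ₖ (1 : Matrix s s ℂ) : Matrix ((c ⊕ c) × s) (c × s) ℂ) * CB) := by
      rw [hVk, Matrix.mul_add, Matrix.mul_smul, Matrix.mul_smul, hC1, hC2]
    rw [Matrix.mul_assoc, this, hVkH]
    simp only [Matrix.add_mul, Matrix.mul_add, Matrix.smul_mul, Matrix.mul_smul,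
      ← Matrix.mul_assoc, ← mul_kronecker_mul, h11, h12, h21, h22, smul_smul, hpp, hqq, smul_zero,
      add_zero, zero_add, Matrix.one_mul, one_kronecker_one, zero_kronecker]
  rw [hfin, quadForm_add, quadForm_smul, quadForm_smul]

end DivForm

/-! ### Continuity of `f`, exact concavity and semicontinuity. -/

section Continuity

/-- The `1 × 1` case turns the operator inequalities into scalar ones for `x ↦ f x⁻¹`. -/
theorem divForm_scalar (f : ℝ → ℝ) {a : ℝ} (ha : 0 < a) :
    divForm f (fun _ : Unit × Unit => (1 : ℂ)) ((a : ℂ) • 1) (1 : Matrix Unit Unit ℂ) = f a⁻¹ := by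
  have ha' : (a : ℂ) ≠ 0 := by exact_mod_cast ha.ne'
  have h : ((a : ℂ) • (1 : Matrix Unit Unit ℂ))⁻¹ ⊗ₖ (1 : Matrix Unit Unit ℂ) =
      diagonal fun _ => ((a⁻¹ : ℝ) : ℂ) := by
    have : ((a : ℂ) • (1 : Matrix Unit Unit ℂ))⁻¹ = (a : ℂ)⁻¹ • 1 :=
      Matrix.inv_eq_left_inv (by
        rw [Matrix.smul_mul, Matrix.one_mul, smul_smul, inv_mul_cancel₀ ha', one_smul])
    rw [this, smul_kronecker, one_kronecker_one, smul_one_eq_diagonal, Complex.ofReal_inv]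
  rw [divForm, h, cfc_diagonal, quadForm]
  simp [dotProduct, mulVec_diagonal]

theorem OperatorAntiMonotone.antitoneOn {f : ℝ → ℝ} (hf : OperatorAntiMonotone f) :
    AntitoneOn f (Set.Ioi 0) := by
  intro a ha b hb hab
  have ha' : (0 : ℝ) < a := ha
  have hb' : (0 : ℝ) < b := hb
  have := divForm_mono_left hf (fun _ : Unit × Unit => (1 : ℂ))
    (smul_posDef (inv_pos.mpr hb') (PosDef.one (n := Unit) (R := ℂ)))
    (PosDef.one (n := Unit) (R := ℂ))
    (smul_le_smul_of_posSemidef (inv_anti₀ ha' hab) PosSemidef.one)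
  rwa [divForm_scalar f (inv_pos.mpr hb'), divForm_scalar f (inv_pos.mpr ha'), inv_inv,
    inv_inv] at this

theorem OperatorAntiMonotone.inv_midpoint {f : ℝ → ℝ} (hf : OperatorAntiMonotone f) {a b x : ℝ}
    (ha : 0 < a) (hb : 0 < b) (hx : a + b < 2 * x) : f a⁻¹ + f b⁻¹ ≤ 2 * f x⁻¹ := by
  -- The loss factor is chosen to carry the midpoint of `a` and `b` exactly to `x`.
  have hr : 0 < 2 * x / (a + b) - 1 := by
    rw [sub_pos, lt_div_iff₀ (by linarith)]; linarith
  have h := divForm_concave_of_slack hf (fun _ : Unit × Unit => (1 : ℂ))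
    (smul_posDef ha (PosDef.one (n := Unit) (R := ℂ)))
    (smul_posDef hb (PosDef.one (n := Unit) (R := ℂ)))
    (PosDef.one (n := Unit) (R := ℂ)) (p := 1 / 2) (q := 1 / 2) (by norm_num) (by norm_num)
    (by norm_num) hr
  rw [smul_smul, smul_smul, ← add_smul, smul_smul, ← Complex.ofReal_mul, ← Complex.ofReal_mul,
    ← Complex.ofReal_add, ← Complex.ofReal_mul] at h
  have hxe : (1 + (2 * x / (a + b) - 1)) * (1 / 2 * a + 1 / 2 * b) = x := by
    have : a + b ≠ 0 := by linarith
    field_simp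
    ring
  rw [hxe, divForm_scalar f ha, divForm_scalar f hb, divForm_scalar f (by linarith)] at h
  linarith

open Filter Topology in
/-- Operator anti-monotone functions are continuous. -/
theorem OperatorAntiMonotone.continuousOn {f : ℝ → ℝ} (hf : OperatorAntiMonotone f) :
    ContinuousOn f (Set.Ioi 0) := by
  suffices h : ContinuousOn (fun x => f x⁻¹) (Set.Ioi 0) by
    have := h.comp (continuousOn_inv₀.mono fun x (hx : 0 < x) => hx.ne')
      (fun x (hx : 0 < x) => inv_pos.mpr hx)
    exact this.congr fun x _ => by simp
  intro x hx
  have hx : 0 < x := hx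
  apply ContinuousAt.continuousWithinAt
  -- Clamping at `x / 2` gives a function monotone on all of `ℝ`, so one-sided limits exist; it
  -- remains to exclude a jump at `x`.
  let G : ℝ → ℝ := fun y => f (max y (x / 2))⁻¹
  have hpos : ∀ y, 0 < max y (x / 2) := fun y => lt_max_of_lt_right (by linarith)
  have hG : Monotone G := fun y z hyz => hf.antitoneOn (inv_pos.mpr (hpos z))
    (inv_pos.mpr (hpos y)) (inv_anti₀ (hpos y) (max_le_max_right _ hyz))
  have hGf : G =ᶠ[𝓝 x] fun y => f y⁻¹ := by
    filter_upwards [Ioi_mem_nhds (show x / 2 < x by linarith)] with y hy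
    simp only [G, max_eq_left (le_of_lt (Set.mem_Ioi.mp hy))]
  suffices hc : ContinuousAt G x from hc.congr hGf
  rw [hG.continuousAt_iff_leftLim_eq_rightLim]
  refine le_antisymm (hG.leftLim_le_rightLim le_rfl) ?_
  have t1 : Tendsto (fun r : ℝ => x - r) (𝓝[>] 0) (𝓝[<] x) := by
    refine tendsto_nhdsWithin_iff.mpr ⟨?_, ?_⟩
    · have : Tendsto (fun r : ℝ => x - r) (𝓝 0) (𝓝 (x - 0)) := by
        apply Continuous.tendsto; fun_prop
      rw [sub_zero] at this
      exact this.mono_left nhdsWithin_le_nhds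
    · filter_upwards [self_mem_nhdsWithin] with r (hr : 0 < r)
      simpa using hr
  have t4 : Tendsto (fun r : ℝ => r / 4) (𝓝[>] 0) (𝓝[>] 0) := by
    refine tendsto_nhdsWithin_iff.mpr ⟨?_, ?_⟩
    · have : Tendsto (fun r : ℝ => r / 4) (𝓝 0) (𝓝 (0 / 4)) := by
        apply Continuous.tendsto; fun_prop
      rw [zero_div] at this
      exact this.mono_left nhdsWithin_le_nhds
    · filter_upwards [self_mem_nhdsWithin] with r (hr : 0 < r)
      simpa using hr
  have t5 : Tendsto (fun r : ℝ => x + r) (𝓝[>] 0) (𝓝[>] x) := by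
    refine tendsto_nhdsWithin_iff.mpr ⟨?_, ?_⟩
    · have : Tendsto (fun r : ℝ => x + r) (𝓝 0) (𝓝 (x + 0)) := by
        apply Continuous.tendsto; fun_prop
      rw [add_zero] at this
      exact this.mono_left nhdsWithin_le_nhds
    · filter_upwards [self_mem_nhdsWithin] with r (hr : 0 < r)
      simpa using hr
  have t2 : Tendsto (fun r : ℝ => x - r / 4) (𝓝[>] 0) (𝓝[<] x) := t1.comp t4
  have t3 : Tendsto (fun r : ℝ => x + r / 4) (𝓝[>] 0) (𝓝[>] x) := t5.comp t4
  -- The midpoint of `x - r` and `x + r / 4` lies strictly below `x - r / 4`, itself below `x`. In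
  -- the limit, left plus right limit is at most twice the left one.
  have hlim := le_of_tendsto_of_tendsto
    (((hG.tendsto_leftLim x).comp t1).add ((hG.tendsto_rightLim x).comp t3))
    (((hG.tendsto_leftLim x).comp t2).const_mul 2) (by
      filter_upwards [Ioo_mem_nhdsGT (show (0 : ℝ) < x / 2 by linarith)] with r hr
      have e1 : max (x - r) (x / 2) = x - r := max_eq_left (by linarith [hr.2])
      have e2 : max (x - r / 4) (x / 2) = x - r / 4 := max_eq_left (by linarith [hr.2, hr.1])
      have e3 : max (x + r / 4) (x / 2) = x + r / 4 := max_eq_left (by linarith [hr.1])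
      simp only [Function.comp_apply, G, e1, e2, e3]
      exact hf.inv_midpoint (by linarith [hr.2]) (by linarith [hr.1]) (by linarith [hr.1]))
  linarith

variable {c s : Type*} [Fintype c] [DecidableEq c] [Fintype s] [DecidableEq s]

theorem continuousAt_divForm_smul {f : ℝ → ℝ} (hf : OperatorAntiMonotone f) (v : c × s → ℂ)
    {τ : Matrix c c ℂ} {Z : Matrix s s ℂ} (hτ : τ.PosDef) (hZ : Z.PosDef) :
    ContinuousAt (fun r : ℝ => divForm f v ((r : ℂ) • τ) Z) 1 := by
  have h := (continuousAt_quadForm_cfc_smul hf.continuousOn v (hτ.inv.kronecker hZ)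
    (r := (1 : ℝ)⁻¹) (by norm_num)).comp (f := fun r : ℝ => r⁻¹)
    (continuousAt_inv₀ one_ne_zero)
  refine h.congr ?_
  filter_upwards [Ioi_mem_nhds (show (0 : ℝ) < 1 from one_pos)] with r hr
  have hr : 0 < r := hr
  have hr0 : (r : ℂ) ≠ 0 := by exact_mod_cast hr.ne'
  simp only [Function.comp_apply, divForm]
  have : ((r : ℂ) • τ)⁻¹ = (((r⁻¹ : ℝ) : ℂ)) • τ⁻¹ := by
    apply Matrix.inv_eq_left_inv
    rw [Matrix.smul_mul, Matrix.mul_smul, smul_smul, Complex.ofReal_inv, inv_mul_cancel₀ hr0,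
      one_smul, nonsing_inv_mul _ ((isUnit_iff_isUnit_det τ).mp hτ.isUnit)]
  rw [this, smul_kronecker]

theorem posDef_convex_comb {A B : Matrix c c ℂ} (hA : A.PosDef) (hB : B.PosDef)
    {p q : ℝ} (hp : 0 ≤ p) (hq : 0 ≤ q) (hpq : p + q = 1) :
    ((p : ℂ) • A + (q : ℂ) • B).PosDef := by
  rcases hp.eq_or_lt with rfl | hp
  · rw [zero_add] at hpq
    simpa [hpq] using hB
  · exact (smul_posDef hp hA).add_posSemidef (smul_posSemidef hq hB.posSemidef)

open Filter Topology in
-- Let the loss factor tend to one, by continuity along the ray through the convex combination.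
theorem divForm_concave {f : ℝ → ℝ} (hf : OperatorAntiMonotone f) (v : c × s → ℂ)
    {A B : Matrix c c ℂ} {Z : Matrix s s ℂ} (hA : A.PosDef) (hB : B.PosDef) (hZ : Z.PosDef)
    {p q : ℝ} (hp : 0 ≤ p) (hq : 0 ≤ q) (hpq : p + q = 1) :
    p * divForm f v A Z + q * divForm f v B Z ≤ divForm f v ((p : ℂ) • A + (q : ℂ) • B) Z := by
  have h := (continuousAt_divForm_smul hf v (posDef_convex_comb hA hB hp hq hpq) hZ).tendsto
  simp only [Complex.ofReal_one, one_smul] at h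
  refine ge_of_tendsto (h.mono_left (nhdsWithin_le_nhds (s := Set.Ioi 1))) ?_
  filter_upwards [self_mem_nhdsWithin] with r (hr : 1 < r)
  have := divForm_concave_of_slack hf v hA hB hZ hp hq hpq (sub_pos.mpr hr)
  rwa [add_sub_cancel] at this

open Filter Topology in
/-- Near a positive definite matrix, Hermitian matrices are below any larger multiple of it. -/
theorem eventually_le_smul {τ : Matrix c c ℂ} (hτ : τ.PosDef) {r : ℝ} (hr : 1 < r) :
    ∀ᶠ τ' in 𝓝 τ, τ'.IsHermitian → τ' ≤ (r : ℂ) • τ := by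
  obtain ⟨l, hl, hle⟩ := exists_smul_one_le hτ
  have hc : Continuous fun τ' : Matrix c c ℂ => ∑ i, ∑ j, ‖(τ' - τ) i j‖ := by
    refine continuous_finsetSum _ fun i _ => continuous_finsetSum _ fun j _ => ?_
    exact ((continuous_id.matrix_elem i j).sub continuous_const).norm
  have h0 := hc.tendsto τ
  simp only [sub_self, Matrix.zero_apply, norm_zero, Finset.sum_const_zero] at h0
  filter_upwards [h0.eventually_lt_const (mul_pos (sub_pos.mpr hr) hl)] with τ' hτ' hH
  have h1 := le_sum_norm_smul_one (hH.sub hτ.isHermitian)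
  have h2 : τ' - τ ≤ ((r - 1 : ℝ) : ℂ) • τ := by
    refine (h1.trans (smul_le_smul_of_posSemidef hτ'.le PosSemidef.one)).trans ?_
    rw [Complex.ofReal_mul, ← smul_smul]
    exact smul_mono (sub_pos.mpr hr).le hle
  have h3 := add_le_add_left h2 τ
  rw [sub_add_cancel] at h3
  refine h3.trans (le_of_eq ?_)
  rw [Complex.ofReal_sub, sub_smul]
  simp

open Filter Topology in
-- Nearby `τ'` satisfy `τ' ≤ r τ` with `r` slightly above one, so monotonicity and continuity along
-- the ray suffice.
theorem upperSemicontinuousOn_divForm {f : ℝ → ℝ} (hf : OperatorAntiMonotone f) (v : c × s → ℂ)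
    {Z : Matrix s s ℂ} (hZ : Z.PosDef) :
    UpperSemicontinuousOn (fun τ => divForm f v τ Z) {τ : Matrix c c ℂ | τ.PosDef} := by
  intro τ hτ y hy
  have h := (continuousAt_divForm_smul hf v hτ hZ).tendsto
  simp only [Complex.ofReal_one, one_smul] at h
  obtain ⟨r, hr, hr1⟩ := ((h.mono_left (nhdsWithin_le_nhds (s := Set.Ioi 1))).eventually_lt_const
    hy |>.and self_mem_nhdsWithin).exists
  filter_upwards [self_mem_nhdsWithin,
    (eventually_le_smul hτ hr1).filter_mono nhdsWithin_le_nhds] with τ' (hτ' : τ'.PosDef) hle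
  exact (divForm_mono_left hf v hτ' hZ (hle hτ'.isHermitian)).trans_lt hr

end Continuity

/-! ### Subnormalized states and a compact family of them. -/

section SubStates

variable {n : Type*} [Fintype n] [DecidableEq n]

/-- Positive definite matrices of trace at most one. -/
def subStates (n : Type*) [Fintype n] : Set (Matrix n n ℂ) := {A | A.PosDef ∧ A.trace ≤ 1}

theorem mem_subStates_iff {A : Matrix n n ℂ} : A ∈ subStates n ↔ A.PosDef ∧ A.trace.re ≤ 1 :=
  and_congr_right fun h => trace_le_one_iff h.isHermitian

/-- A multiple of the identity with trace less than one half. -/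
noncomputable def smallState (n : Type*) [Fintype n] [DecidableEq n] : Matrix n n ℂ :=
  (((2 * ((Fintype.card n : ℝ) + 1))⁻¹ : ℝ) : ℂ) • 1

theorem smallState_posDef : (smallState n).PosDef :=
  smul_posDef (by positivity) PosDef.one

theorem smallState_trace : (smallState n).trace.re ≤ 1 / 2 := by
  rw [smallState, trace_smul, trace_one, smul_eq_mul, Complex.re_ofReal_mul, Complex.natCast_re,
    inv_mul_le_iff₀ (by positivity)]
  linarith

theorem trace_comb_re (p q : ℝ) (A B : Matrix n n ℂ) :
    ((p : ℂ) • A + (q : ℂ) • B).trace.re = p * A.trace.re + q * B.trace.re := by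
  simp [trace_add, trace_smul]

theorem convex_subStates : Convex ℝ (subStates n) := by
  intro A hA B hB p q hp hq hpq
  rw [mem_subStates_iff] at hA hB ⊢
  have h := posDef_convex_comb hA.1 hB.1 hp hq hpq
  have h2 := trace_comb_re p q A B
  simp only [Complex.coe_smul] at h h2
  refine ⟨h, ?_⟩
  rw [h2]
  calc p * A.trace.re + q * B.trace.re ≤ p * 1 + q * 1 :=
        add_le_add (mul_le_mul_of_nonneg_left hA.2 hp) (mul_le_mul_of_nonneg_left hB.2 hq)
    _ = 1 := by linarith

/-- Positive semi-definite matrices of trace at most one, mixed with the state `smallState`. -/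
noncomputable def mixedStates (n : Type*) [Fintype n] [DecidableEq n] (t : ℝ) :
    Set (Matrix n n ℂ) :=
  (fun A : Matrix n n ℂ => ((1 - t : ℝ) : ℂ) • A + (t : ℂ) • smallState n) ''
    {A | A.PosSemidef ∧ A.trace.re ≤ 1}

theorem mixedStates_subset {t : ℝ} (ht : 0 < t) (ht1 : t < 1) :
    mixedStates n t ⊆ subStates n := by
  rintro _ ⟨A, ⟨hA, hA1⟩, rfl⟩
  rw [mem_subStates_iff]
  refine ⟨(smul_posDef ht smallState_posDef).posSemidef_add
    (smul_posSemidef (by linarith) hA), ?_⟩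
  simp only
  rw [trace_comb_re]
  nlinarith [smallState_trace (n := n)]

theorem convex_mixedStates (t : ℝ) : Convex ℝ (mixedStates n t) := by
  rintro _ ⟨A, ⟨hA, hA1⟩, rfl⟩ _ ⟨B, ⟨hB, hB1⟩, rfl⟩ p q hp hq hpq
  refine ⟨(p : ℂ) • A + (q : ℂ) • B,
    ⟨(smul_posSemidef hp hA).add (smul_posSemidef hq hB), ?_⟩, ?_⟩
  · rw [trace_comb_re]
    calc p * A.trace.re + q * B.trace.re ≤ p * 1 + q * 1 :=
        add_le_add (mul_le_mul_of_nonneg_left hA1 hp) (mul_le_mul_of_nonneg_left hB1 hq)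
      _ = 1 := by linarith
  · have hq' : q = 1 - p := by linarith
    subst hq'
    ext i j
    simp
    ring

/-- Positive semi-definite matrices are the `Bᴴ * B`, so the set is a continuous image of a
Hilbert–Schmidt ball. -/
theorem isCompact_mixedStates (t : ℝ) : IsCompact (mixedStates n t) := by
  have hK : IsCompact {B : Matrix n n ℂ | (Bᴴ * B).trace.re ≤ 1} := by
    have hbox : IsCompact (Set.univ.pi fun _ : n => Set.univ.pi fun _ : n =>
        Metric.closedBall (0 : ℂ) 1) :=
      isCompact_univ_pi fun _ => isCompact_univ_pi fun _ => isCompact_closedBall 0 1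
    refine IsCompact.of_isClosed_subset (X := Matrix n n ℂ) hbox ?_ ?_
    · refine isClosed_le ?_ continuous_const
      exact Complex.continuous_re.comp
        ((continuous_id.matrix_conjTranspose.matrix_mul continuous_id).matrix_trace)
    · intro B hB i _ j _
      have hB : (Bᴴ * B).trace.re ≤ 1 := hB
      have he : (Bᴴ * B).trace.re = ∑ l, ∑ k, ‖B k l‖ ^ 2 := by
        simp [trace, Matrix.mul_apply, Complex.conj_mul', ← Complex.ofReal_pow]
      have h1 : ‖B i j‖ ^ 2 ≤ ∑ k, ‖B k j‖ ^ 2 :=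
        Finset.single_le_sum (f := fun k => ‖B k j‖ ^ 2) (fun k _ => by positivity)
          (Finset.mem_univ i)
      have h2 : ∑ k, ‖B k j‖ ^ 2 ≤ ∑ l, ∑ k, ‖B k l‖ ^ 2 :=
        Finset.single_le_sum (f := fun l => ∑ k, ‖B k l‖ ^ 2) (fun k _ => by positivity)
          (Finset.mem_univ j)
      rw [mem_closedBall_zero_iff]
      nlinarith [norm_nonneg (B i j)]
  have himg : mixedStates n t = (fun B : Matrix n n ℂ =>
      ((1 - t : ℝ) : ℂ) • (Bᴴ * B) + (t : ℂ) • smallState n) ''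
        {B | (Bᴴ * B).trace.re ≤ 1} := by
    ext M
    constructor
    · rintro ⟨A, ⟨hA, hA1⟩, rfl⟩
      obtain ⟨B, rfl⟩ := CStarAlgebra.nonneg_iff_eq_star_mul_self.mp hA.nonneg
      exact ⟨B, hA1, rfl⟩
    · rintro ⟨B, hB, rfl⟩
      exact ⟨Bᴴ * B, ⟨posSemidef_conjTranspose_mul_self B, hB⟩, rfl⟩
  rw [himg]
  have hc : Continuous fun B : Matrix n n ℂ => Bᴴ * B :=
    continuous_id.matrix_conjTranspose.matrix_mul continuous_id
  exact hK.image (f := fun B : Matrix n n ℂ =>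
    ((1 - t : ℝ) : ℂ) • (Bᴴ * B) + (t : ℂ) • smallState n) (by fun_prop)

theorem add_kerProj_posDef {Y : Matrix n n ℂ} (hY : Y.PosSemidef) {ε : ℝ} (hε : 0 < ε) :
    (Y + (ε : ℂ) • kerProj Y).PosDef := by
  obtain ⟨U, hU, hU', hYU, hf⟩ := exists_diagonalization hY.isHermitian
  have h : Y + (ε : ℂ) • kerProj Y = U * diagonal (fun i => ((hY.isHermitian.eigenvalues i +
      ε * (if hY.isHermitian.eigenvalues i = 0 then 1 else 0) : ℝ) : ℂ)) * Uᴴ := by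
    have : diagonal (fun i => ((hY.isHermitian.eigenvalues i +
      ε * (if hY.isHermitian.eigenvalues i = 0 then 1 else 0) : ℝ) : ℂ)) =
      diagonal (fun i => (hY.isHermitian.eigenvalues i : ℂ)) + (ε : ℂ) • diagonal (fun i =>
        (((if hY.isHermitian.eigenvalues i = 0 then 1 else 0) : ℝ) : ℂ)) := by
      rw [← diagonal_smul, diagonal_add]
      congr 1
      ext i
      by_cases h0 : hY.isHermitian.eigenvalues i = 0 <;> simp [h0]
    rw [this, Matrix.mul_add, Matrix.add_mul, ← hYU, kerProj, hf, Matrix.mul_smul, Matrix.smul_mul]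
  rw [h]
  apply PosDef.mul_mul_conjTranspose_same
  · apply PosDef.diagonal
    intro i
    have := hY.eigenvalues_nonneg i
    norm_cast
    split_ifs with h0
    · rw [h0]; simpa using hε
    · simpa using lt_of_le_of_ne this (Ne.symm h0)
  · intro x y hxy
    have := congrArg (fun z => z ᵥ* Uᴴ) hxy
    simpa [hU'] using this

theorem kerProj_eq_zero {Y : Matrix n n ℂ} (hY : Y.PosDef) : kerProj Y = 0 := by
  obtain ⟨U, hU, hU', hYU, hf⟩ := exists_diagonalization hY.isHermitian
  rw [kerProj, hf]
  have : (fun i => (((if hY.isHermitian.eigenvalues i = 0 then 1 else 0) : ℝ) : ℂ)) = 0 := by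
    ext i
    simp [(hY.eigenvalues_pos i).ne']
  rw [this]
  simp

end SubStates

/-! ### The two-variable form and its minimax equality. -/

section CondForm

variable {a b c : Type*} [Fintype a] [DecidableEq a] [Fintype b] [DecidableEq b]
  [Fintype c] [DecidableEq c]

/-- The number `⟨v| f(τ_C⁻¹ ⊗ I_A ⊗ σ_B) |v⟩`. -/
noncomputable def condForm (f : ℝ → ℝ) (v : c × a × b → ℂ) (σ : Matrix b b ℂ)
    (τ : Matrix c c ℂ) : ℝ :=
  divForm f v τ ((1 : Matrix a a ℂ) ⊗ₖ σ)

/-- Exchange of the first and the third factor. -/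
def swapVec (v : c × a × b → ℂ) : b × a × c → ℂ := fun p => v (p.2.2, p.2.1, p.1)

theorem one_kronecker_posDef {σ : Matrix b b ℂ} (hσ : σ.PosDef) :
    ((1 : Matrix a a ℂ) ⊗ₖ σ).PosDef := PosDef.one.kronecker hσ

/-- The source of the dual function: `(σ⁻¹ ⊗ I ⊗ τ)⁻¹` is `τ⁻¹ ⊗ I ⊗ σ` with the outer factors
exchanged. -/
theorem condForm_swap (f : ℝ → ℝ) (v : c × a × b → ℂ) {σ : Matrix b b ℂ} {τ : Matrix c c ℂ}
    (hσ : σ.PosDef) (hτ : τ.PosDef) :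
    condForm (dualFun f) (swapVec v) τ σ = -condForm f v σ τ := by
  let e : b × a × c ≃ c × a × b :=
    ⟨fun p => (p.2.2, p.2.1, p.1), fun p => (p.2.2, p.2.1, p.1), fun _ => rfl, fun _ => rfl⟩
  have hpos := hτ.inv.kronecker (one_kronecker_posDef (a := a) hσ)
  have hinv : (σ⁻¹ ⊗ₖ ((1 : Matrix a a ℂ) ⊗ₖ τ))⁻¹ =
      (τ⁻¹ ⊗ₖ ((1 : Matrix a a ℂ) ⊗ₖ σ)).submatrix e e := by
    rw [inv_kronecker, inv_kronecker, inv_one,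
      nonsing_inv_nonsing_inv _ ((isUnit_iff_isUnit_det σ).mp hσ.isUnit)]
    ext i j
    simp only [kroneckerMap_apply, submatrix_apply, e, Equiv.coe_fn_mk]
    ring
  rw [condForm, divForm, cfc_dualFun f (hσ.inv.kronecker (one_kronecker_posDef hτ)), hinv,
    cfc_submatrix f hpos.isHermitian, quadForm_neg, condForm, divForm,
    ← quadForm_submatrix e v]
  rfl

theorem condForm_mono {f : ℝ → ℝ} (hf : OperatorAntiMonotone f) (v : c × a × b → ℂ)
    {σ : Matrix b b ℂ} {τ τ' : Matrix c c ℂ} (hσ : σ.PosDef) (hτ : τ.PosDef) (h : τ ≤ τ') :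
    condForm f v σ τ ≤ condForm f v σ τ' :=
  divForm_mono_left hf v hτ (one_kronecker_posDef hσ) h

theorem condForm_anti {f : ℝ → ℝ} (hf : OperatorAntiMonotone f) (v : c × a × b → ℂ)
    {σ σ' : Matrix b b ℂ} {τ : Matrix c c ℂ} (hσ : σ.PosDef) (hτ : τ.PosDef) (h : σ ≤ σ') :
    condForm f v σ' τ ≤ condForm f v σ τ :=
  divForm_anti_right hf v hτ (one_kronecker_posDef hσ)
    (kronecker_mono_right h PosSemidef.one)

theorem condForm_concave {f : ℝ → ℝ} (hf : OperatorAntiMonotone f) (v : c × a × b → ℂ)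
    {σ : Matrix b b ℂ} {A B : Matrix c c ℂ} (hσ : σ.PosDef) (hA : A.PosDef) (hB : B.PosDef)
    {p q : ℝ} (hp : 0 ≤ p) (hq : 0 ≤ q) (hpq : p + q = 1) :
    p * condForm f v σ A + q * condForm f v σ B ≤ condForm f v σ ((p : ℂ) • A + (q : ℂ) • B) :=
  divForm_concave hf v hA hB (one_kronecker_posDef hσ) hp hq hpq

theorem condForm_convex {f : ℝ → ℝ} (hf : OperatorAntiMonotone f) (v : c × a × b → ℂ)
    {A B : Matrix b b ℂ} {τ : Matrix c c ℂ} (hA : A.PosDef) (hB : B.PosDef) (hτ : τ.PosDef)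
    {p q : ℝ} (hp : 0 ≤ p) (hq : 0 ≤ q) (hpq : p + q = 1) :
    condForm f v ((p : ℂ) • A + (q : ℂ) • B) τ ≤ p * condForm f v A τ + q * condForm f v B τ := by
  have := condForm_concave hf.dualFun (swapVec v) hτ hA hB hp hq hpq
  rw [condForm_swap f v hA hτ, condForm_swap f v hB hτ,
    condForm_swap f v (posDef_convex_comb hA hB hp hq hpq) hτ] at this
  linarith

theorem upperSemicontinuousOn_condForm {f : ℝ → ℝ} (hf : OperatorAntiMonotone f)
    (v : c × a × b → ℂ) {σ : Matrix b b ℂ} (hσ : σ.PosDef) :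
    UpperSemicontinuousOn (fun τ => condForm f v σ τ) {τ : Matrix c c ℂ | τ.PosDef} :=
  upperSemicontinuousOn_divForm hf v (one_kronecker_posDef hσ)

theorem lowerSemicontinuousOn_condForm {f : ℝ → ℝ} (hf : OperatorAntiMonotone f)
    (v : c × a × b → ℂ) {τ : Matrix c c ℂ} (hτ : τ.PosDef) :
    LowerSemicontinuousOn (fun σ => condForm f v σ τ) {σ : Matrix b b ℂ | σ.PosDef} := by
  intro σ hσ y hy
  have h := upperSemicontinuousOn_condForm hf.dualFun (swapVec v) hτ σ hσ (-y) (by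
    simp only [condForm_swap f v hσ hτ]; exact neg_lt_neg hy)
  filter_upwards [h, self_mem_nhdsWithin] with σ' h' (hσ' : σ'.PosDef)
  rw [condForm_swap f v hσ' hτ] at h'
  exact neg_lt_neg_iff.mp h'

theorem condForm_smallState_le {f : ℝ → ℝ} (hf : OperatorAntiMonotone f) (v : c × a × b → ℂ)
    {τ : Matrix c c ℂ} (hτ : τ ∈ subStates c) :
    condForm f v (smallState b) τ ≤ condForm f v (smallState b) 1 :=
  condForm_mono hf v smallState_posDef hτ.1 (le_one_of_trace_le_one hτ.1.posSemidef hτ.2)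

/-- The error term is independent of `τ`, because `τ ≤ 1` on `subStates`. This uniformity lets
mixing pass through the supremum over `τ`. -/
theorem condForm_mix_le {f : ℝ → ℝ} (hf : OperatorAntiMonotone f) (v : c × a × b → ℂ)
    {σ : Matrix b b ℂ} {τ : Matrix c c ℂ} (hσ : σ.PosDef) (hτ : τ ∈ subStates c) {t : ℝ}
    (ht : 0 ≤ t) (ht1 : t ≤ 1) :
    condForm f v (((1 - t : ℝ) : ℂ) • σ + (t : ℂ) • smallState b) τ ≤
      (1 - t) * condForm f v σ τ + t * condForm f v (smallState b) 1 :=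
  (condForm_convex hf v hσ smallState_posDef hτ.1 (by linarith) ht (by ring)).trans
    (add_le_add_right (mul_le_mul_of_nonneg_left (condForm_smallState_le hf v hτ) ht) _)

/-- A gap would contain `r < r'`. Sion's theorem on mixed `σ` gives a `τ` with all mixed values
above `r'`, although some unmixed value is below `r`; for a small mixing weight `t` this contradicts
`condForm_mix_le`. -/
theorem condForm_minimax {f : ℝ → ℝ} (hf : OperatorAntiMonotone f) (v : c × a × b → ℂ) :
    (⨅ σ ∈ subStates b, ⨆ τ ∈ subStates c, (condForm f v σ τ : EReal)) =
      ⨆ τ ∈ subStates c, ⨅ σ ∈ subStates b, (condForm f v σ τ : EReal) := by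
  refine le_antisymm ?_ (iSup₂_iInf₂_le_iInf₂_iSup₂ _ _ _)
  by_contra! hlt
  obtain ⟨r, hr, hr'⟩ := EReal.lt_iff_exists_real_btwn.mp hlt
  obtain ⟨r', hrr', hr'⟩ := EReal.lt_iff_exists_real_btwn.mp hr'
  have hrr' : r < r' := by exact_mod_cast hrr'
  set M := condForm f v (smallState b) 1 with hM
  obtain ⟨t, ht, ht1, htM⟩ : ∃ t : ℝ, 0 < t ∧ t < 1 ∧ (1 - t) * r + t * M < r' := by
    have hd : 0 < (r' - r) + |M - r| + 1 := by have := abs_nonneg (M - r); linarith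
    have h0 := abs_nonneg (M - r)
    refine ⟨(r' - r) / ((r' - r) + |M - r| + 1), div_pos (by linarith) hd,
      (div_lt_one hd).mpr (by linarith), ?_⟩
    have h1 : (r' - r) / ((r' - r) + |M - r| + 1) * |M - r| < r' - r := by
      rw [div_mul_eq_mul_div, div_lt_iff₀ hd]
      exact mul_lt_mul_of_pos_left (by linarith) (by linarith)
    have h2 := mul_le_mul_of_nonneg_left (le_abs_self (M - r))
      (div_pos (show 0 < r' - r by linarith) hd).le
    linarith
  have hsub := mixedStates_subset (n := b) ht ht1
  have hne : (mixedStates b t).Nonempty :=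
    ⟨_, 0, ⟨PosSemidef.zero, by simp⟩, rfl⟩
  have hsion := Sion.minimax' (X := mixedStates b t) (Y := subStates c)
    (f := fun σ τ => (condForm f v σ τ : EReal)) hne (convex_mixedStates t)
    (isCompact_mixedStates t)
    (fun τ hτ => continuous_coe_real_ereal.comp_lowerSemicontinuousOn
      ((lowerSemicontinuousOn_condForm hf v hτ.1).mono fun σ hσ => (hsub hσ).1)
      EReal.coe_strictMono.monotone)
    (fun τ hτ => (ConvexOn.quasiconvexOn (f := fun σ => condForm f v σ τ)
      ⟨convex_mixedStates t, fun A hA B hB p q hp hq hpq => by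
        simpa using condForm_convex hf v (hsub hA).1 (hsub hB).1 hτ.1 hp hq hpq⟩).monotone_comp
      (g := Real.toEReal) EReal.coe_strictMono.monotone)
    convex_subStates
    (fun σ hσ => continuous_coe_real_ereal.comp_upperSemicontinuousOn
      ((upperSemicontinuousOn_condForm hf v (hsub hσ).1).mono fun τ hτ => hτ.1)
      EReal.coe_strictMono.monotone)
    (fun σ hσ => (ConcaveOn.quasiconcaveOn (f := fun τ => condForm f v σ τ)
      ⟨convex_subStates, fun A hA B hB p q hp hq hpq => by
        simpa using condForm_concave hf v (hsub hσ).1 hA.1 hB.1 hp hq hpq⟩).monotone_comp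
      (g := Real.toEReal) EReal.coe_strictMono.monotone)
  -- Restricting `σ` to the mixed states can only raise the infimum.
  have h1 : (r' : EReal) < ⨆ τ ∈ subStates c, ⨅ σ ∈ mixedStates b t, (condForm f v σ τ : EReal) := by
    rw [← hsion]
    exact hr'.trans_le (biInf_mono hsub)
  obtain ⟨τ, hτ, h2⟩ := lt_biSup_iff.mp h1
  have h3 : (⨅ σ ∈ subStates b, (condForm f v σ τ : EReal)) < r :=
    (le_biSup (fun τ => ⨅ σ ∈ subStates b, (condForm f v σ τ : EReal)) hτ).trans_lt hr
  obtain ⟨σ, h4⟩ := iInf_lt_iff.mp h3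
  obtain ⟨hσ, h4⟩ := iInf_lt_iff.mp h4
  have h5 := h2.trans_le (biInf_le (fun σ => (condForm f v σ τ : EReal))
    (show _ ∈ mixedStates b t from
      ⟨σ, ⟨hσ.1.posSemidef, (mem_subStates_iff.mp hσ).2⟩, rfl⟩))
  have h4 : condForm f v σ τ < r := by exact_mod_cast h4
  have h5 : r' < condForm f v (((1 - t : ℝ) : ℂ) • σ + (t : ℂ) • smallState b) τ := by
    exact_mod_cast h5
  have h6 := condForm_mix_le hf v hσ.1 hτ ht.le ht1.le
  have h7 := mul_le_mul_of_nonneg_left h4.le (show 0 ≤ 1 - t by linarith)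
  linarith

end CondForm

/-! ### Independence of the purifying system. -/

section Purification

variable {c d s : Type*} [Fintype c] [DecidableEq c] [Fintype d] [DecidableEq d]
  [Fintype s] [DecidableEq s]

/-- The entries of a matrix as a vector on the product of its index types. -/
def toVec (N : Matrix c s ℂ) : c × s → ℂ := fun p => N p.1 p.2

theorem kronecker_one_mulVec_toVec (V : Matrix c d ℂ) (N : Matrix d s ℂ) :
    (V ⊗ₖ (1 : Matrix s s ℂ)) *ᵥ toVec N = toVec (V * N) := by
  ext ⟨k, q⟩
  simp [mulVec, dotProduct, toVec, Matrix.mul_apply, Fintype.sum_prod_type, Matrix.one_apply]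

theorem phiVec_eq_toVec (X : Matrix s s ℂ) : phiVec X = toVec (cfc Real.sqrt X) := by
  have h : gammaVec s = toVec (1 : Matrix s s ℂ) := by
    ext p
    simp [gammaVec, toVec, Matrix.one_apply]
  rw [phiVec, h, kronecker_one_mulVec_toVec, Matrix.mul_one]

theorem trace_conj_partialIsometry_le {V : Matrix c d ℂ} (hV : V * Vᴴ * V = V) {τ : Matrix c c ℂ}
    (hτ : τ.PosSemidef) : (Vᴴ * τ * V).trace.re ≤ τ.trace.re := by
  have hQ : (1 - V * Vᴴ)ᴴ = 1 - V * Vᴴ := by simp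
  have hQQ : (1 - V * Vᴴ) * (1 - V * Vᴴ) = 1 - V * Vᴴ := by
    have : V * Vᴴ * (V * Vᴴ) = V * Vᴴ := by rw [← Matrix.mul_assoc, hV]
    simp [Matrix.sub_mul, Matrix.mul_sub, this]
  have h := (hτ.conjTranspose_mul_mul_same (1 - V * Vᴴ)).trace_nonneg
  rw [hQ, trace_mul_comm, ← Matrix.mul_assoc, hQQ, Matrix.sub_mul, Matrix.one_mul, trace_sub,
    Matrix.mul_assoc, trace_mul_comm V] at h
  have := (Complex.le_def.mp h).1
  simpa using this

open Filter Topology in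
-- Shrinking `τ` to `r τ` with `r < 1` makes room in the trace for the loss factor and the
-- regularization of the Jensen inequality; then `r → 1`.
theorem divForm_toVec_mul_le_iSup {f : ℝ → ℝ} (hf : OperatorAntiMonotone f) {V : Matrix c d ℂ}
    (hV : V * Vᴴ * V = V) {N : Matrix d s ℂ} (hN : Vᴴ * V * N = N) {Z : Matrix s s ℂ}
    (hZ : Z.PosDef) {τ : Matrix c c ℂ} (hτ : τ ∈ subStates c) :
    (divForm f (toVec (V * N)) τ Z : EReal) ≤
      ⨆ τ' ∈ subStates d, (divForm f (toVec N) τ' Z : EReal) := by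
  have hτ1 := (mem_subStates_iff.mp hτ).2
  have hcont := (continuousAt_divForm_smul hf (toVec (V * N)) hτ.1 hZ).tendsto
  simp only [Complex.ofReal_one, one_smul] at hcont
  have hcont := (continuous_coe_real_ereal.tendsto _).comp hcont
  refine le_of_tendsto (hcont.mono_left (nhdsWithin_le_nhds (s := Set.Iio 1))) ?_
  filter_upwards [Ioo_mem_nhdsLT (show (0 : ℝ) < 1 from one_pos)] with r ⟨hr0, hr1⟩
  -- The regularization has trace at most `(1 - r) ^ 2`, and the trace budget closes exactly: `(1 +
  -- (1 - r)) * r + (1 - r) ^ 2 = 1`.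
  set t : ℝ := (1 - r) ^ 2 / ((Fintype.card d : ℝ) + 1) with ht
  have htpos : 0 < t := div_pos (pow_pos (by linarith) 2) (by positivity)
  have h := divForm_partialIsometry_le hf hV (x := toVec N)
    (by rw [kronecker_one_mulVec_toVec, hN]) (smul_posDef hr0 hτ.1) hZ
    (show 0 < 1 - r by linarith) htpos
  refine le_iSup₂_of_le _ ⟨posDef_partialIsometry hV (smul_posDef hr0 hτ.1)
    (show 0 < 1 + (1 - r) by linarith) htpos, ?_⟩ ?_
  · rw [trace_le_one_iff (posDef_partialIsometry hV (smul_posDef hr0 hτ.1)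
      (show 0 < 1 + (1 - r) by linarith) htpos).isHermitian, trace_comb_re]
    have h1 := trace_conj_partialIsometry_le hV hτ.1.posSemidef
    have h2 : (Vᴴ * ((r : ℂ) • τ) * V).trace.re = r * (Vᴴ * τ * V).trace.re := by
      simp [trace_smul]
    have h3 : (1 - Vᴴ * V).trace.re ≤ (Fintype.card d : ℝ) := by
      have := (Complex.le_def.mp (posSemidef_conjTranspose_mul_self V).trace_nonneg).1
      rw [trace_sub, trace_one, Complex.sub_re, Complex.natCast_re]
      simpa using this
    have h4 : t * (1 - Vᴴ * V).trace.re ≤ (1 - r) ^ 2 := by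
      calc _ ≤ t * ((Fintype.card d : ℝ) + 1) :=
            mul_le_mul_of_nonneg_left (by linarith) htpos.le
        _ = _ := div_mul_cancel₀ _ (by positivity)
    have h5 : (1 + (1 - r)) * r * (Vᴴ * τ * V).trace.re ≤ (1 + (1 - r)) * r * 1 :=
      mul_le_mul_of_nonneg_left (h1.trans hτ1) (mul_nonneg (by linarith) hr0.le)
    rw [h2]
    linarith
  · rw [← kronecker_one_mulVec_toVec]
    exact EReal.coe_le_coe_iff.mpr h

/-- The optimization over `τ` only depends on the vector through its marginal: it may be carried
out on any purifying system. -/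
theorem iSup_divForm_phiVec {f : ℝ → ℝ} (hf : OperatorAntiMonotone f) (N : Matrix c s ℂ)
    {Z : Matrix s s ℂ} (hZ : Z.PosDef) :
    (⨆ τ ∈ subStates s, (divForm f (phiVec (Nᴴ * N)) τ Z : EReal)) =
      ⨆ τ ∈ subStates c, (divForm f (toVec N) τ Z : EReal) := by
  set X := Nᴴ * N with hX
  have hXpos : X.PosSemidef := posSemidef_conjTranspose_mul_self N
  have hc := fun g => continuousOn_spectrum hXpos.isHermitian g
  have hspec : ∀ x ∈ spectrum ℝ X, 0 ≤ x := by
    intro x hx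
    rw [hXpos.isHermitian.spectrum_real_eq_range_eigenvalues] at hx
    obtain ⟨i, rfl⟩ := hx
    exact hXpos.eigenvalues_nonneg i
  have hmul : ∀ g h : ℝ → ℝ, cfc g X * cfc h X = cfc (fun x => g x * h x) X :=
    fun g h => (cfc_mul g h X (hc g) (hc h)).symm
  have hcong : ∀ g h : ℝ → ℝ, (∀ x, 0 ≤ x → g x = h x) → cfc g X = cfc h X :=
    fun g h hgh => cfc_congr fun x hx => hgh x (hspec x hx)
  have hXid : cfc (fun x : ℝ => x) X = X := cfc_id' ℝ X hXpos.isHermitian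
  set R := cfc Real.sqrt X with hR
  -- Since `0⁻¹ = 0`, `J` is the pseudo-inverse of `R = √X`, and `P` below is the support
  -- projection.
  set J := cfc (fun x => (√x)⁻¹) X with hJ
  set P := cfc (fun x => if x = 0 then 0 else 1 : ℝ → ℝ) X with hP
  have hPX : X * P = X := by
    conv_lhs => rw [← hXid]
    rw [hmul]
    refine (hcong _ _ fun x _ => ?_).trans hXid
    split_ifs with h <;> simp [h]
  have hPH : Pᴴ = P := isHermitian_cfc _ X
  have hJH : Jᴴ = J := isHermitian_cfc _ X
  have hNP : N * P = N := by
    have h0 : (N * (1 - P))ᴴ * (N * (1 - P)) = 0 := by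
      rw [conjTranspose_mul, Matrix.mul_assoc, ← Matrix.mul_assoc Nᴴ, ← hX, Matrix.mul_sub X, hPX,
        Matrix.mul_one, sub_self, Matrix.mul_zero]
    have h1 := conjTranspose_mul_self_eq_zero.mp h0
    rw [Matrix.mul_sub, Matrix.mul_one, sub_eq_zero] at h1
    exact h1.symm
  have hJR : J * R = P := by
    rw [hJ, hR, hmul]
    refine hcong _ _ fun x hx => ?_
    split_ifs with h
    · simp [h]
    · exact inv_mul_cancel₀ (Real.sqrt_ne_zero'.mpr (lt_of_le_of_ne hx (Ne.symm h)))
  have hPR : P * R = R := by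
    rw [hP, hR, hmul]
    refine hcong _ _ fun x hx => ?_
    split_ifs with h <;> simp [h]
  have hJP : J * P = J := by
    rw [hP, hJ, hmul]
    refine hcong _ _ fun x hx => ?_
    split_ifs with h <;> simp [h]
  have hJXJ : J * X * J = P := by
    conv_lhs => rw [← hXid]
    rw [hJ, hmul, hmul]
    refine hcong _ _ fun x hx => ?_
    split_ifs with h
    · simp [h]
    · have h0 := Real.sqrt_ne_zero'.mpr (lt_of_le_of_ne hx (Ne.symm h))
      nth_rewrite 2 [← Real.mul_self_sqrt hx]
      field_simp
  -- Polar decomposition: `N = V R` with a partial isometry `V`, and `Vᴴ N = R`. The two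
  -- inequalities use `Vᴴ` and `V`.
  set V := N * J with hV
  have hVR : V * R = N := by rw [hV, Matrix.mul_assoc, hJR, hNP]
  have hVV : Vᴴ * V = P := by
    rw [hV, conjTranspose_mul, hJH, Matrix.mul_assoc, ← Matrix.mul_assoc Nᴴ, ← hX,
      ← Matrix.mul_assoc, hJXJ]
  have hVP : V * P = V := by rw [hV, Matrix.mul_assoc, hJP]
  have hVVV : V * Vᴴ * V = V := by rw [Matrix.mul_assoc, hVV, hVP]
  have hVN : Vᴴ * N = R := by rw [← hVR, ← Matrix.mul_assoc, hVV, hPR]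
  rw [phiVec_eq_toVec]
  refine le_antisymm (iSup₂_le fun τ hτ => ?_) (iSup₂_le fun τ hτ => ?_)
  · have := divForm_toVec_mul_le_iSup hf (V := Vᴴ) (N := N)
      (by rw [conjTranspose_conjTranspose, hVV, ← hVV, hVV, ← hPH, ← conjTranspose_mul, hVP])
      (by rw [conjTranspose_conjTranspose, Matrix.mul_assoc, hVN, hVR]) hZ hτ
    rwa [hVN] at this
  · have := divForm_toVec_mul_le_iSup hf (V := V) (N := R) hVVV (by rw [hVV, hPR]) hZ hτ
    rwa [hVR] at this

theorem optDiv_eq_iSup (f : ℝ → ℝ) (X Y : Matrix s s ℂ) :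
    optDiv f X Y = ⨆ (ε : ℝ) (_ : 0 < ε), ⨆ τ ∈ subStates s,
      (divForm f (phiVec X) τ (Y + (ε : ℂ) • kerProj Y)ᵀ : EReal) := by
  refine le_antisymm ?_ ?_
  · refine iSup_le fun τ => iSup_le fun h1 => iSup_le fun h2 => iSup₂_le fun ε hε => ?_
    exact le_iSup₂_of_le ε hε (le_iSup₂_of_le τ ⟨h1, h2⟩ le_rfl)
  · refine iSup₂_le fun ε hε => iSup₂_le fun τ hτ => ?_
    exact le_iSup_of_le τ (le_iSup_of_le hτ.1 (le_iSup_of_le hτ.2 (le_iSup₂_of_le ε hε le_rfl)))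

end Purification

/-! ### Reduction of the entropies to the minimax problem. -/

section Duality

variable {a b c : Type*} [Fintype a] [DecidableEq a] [Fintype b] [DecidableEq b]
  [Fintype c] [DecidableEq c]

open Filter Topology in
-- For `≤`, a multiple of the identity fills the missing trace; this lowers the form, and the
-- resulting state is invertible, so its kernel projection vanishes. For `≥`, one small `ε` and
-- mixing with `smallState` give an admissible invertible matrix, at a cost vanishing with `t`.
theorem iInf_density_condForm [Nonempty b] {f : ℝ → ℝ} (hf : OperatorAntiMonotone f)
    (v : c × a × b → ℂ) :
    (⨅ (σ : Matrix b b ℂ) (_ : IsDensity σ), ⨆ (ε : ℝ) (_ : 0 < ε), ⨆ τ ∈ subStates c,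
      (condForm f v (σ + (ε : ℂ) • kerProj σ)ᵀ τ : EReal)) =
      ⨅ σ ∈ subStates b, ⨆ τ ∈ subStates c, (condForm f v σ τ : EReal) := by
  refine le_antisymm (le_iInf₂ fun σ hσ => ?_) (le_iInf₂ fun σ hσ => ?_)
  · have hcard : (0 : ℝ) < Fintype.card b := by exact_mod_cast Fintype.card_pos
    set l : ℝ := (1 - σ.trace.re) / Fintype.card b with hl
    have hl0 : 0 ≤ l := div_nonneg (by linarith [(mem_subStates_iff.mp hσ).2]) hcard.le
    set ρ : Matrix b b ℂ := σᵀ + (l : ℂ) • 1 with hρ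
    have hρpos : ρ.PosDef :=
      (hσ.1.transpose).add_posSemidef (smul_posSemidef hl0 PosSemidef.one)
    have hρT : ρᵀ = σ + (l : ℂ) • 1 := by rw [hρ]; simp
    have hρd : IsDensity ρ := by
      refine ⟨hρpos.posSemidef, Complex.ext ?_ ?_⟩
      · rw [hρ, trace_add, trace_transpose, trace_smul, trace_one, smul_eq_mul, Complex.add_re,
          Complex.re_ofReal_mul, Complex.natCast_re, hl]
        field_simp
        simp
      · rw [trace_im_eq_zero hρpos.isHermitian, Complex.one_im]
    refine iInf₂_le_of_le ρ hρd (iSup₂_le fun ε hε => iSup₂_mono fun τ hτ => ?_)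
    rw [kerProj_eq_zero hρpos, smul_zero, add_zero, hρT]
    norm_cast
    refine condForm_anti hf v hσ.1 hτ.1 ?_
    exact le_add_of_nonneg_right (smul_posSemidef hl0 PosSemidef.one).nonneg
  · set S := ⨆ (ε : ℝ) (_ : 0 < ε), ⨆ τ ∈ subStates c,
      (condForm f v (σ + (ε : ℂ) • kerProj σ)ᵀ τ : EReal)
    have hle : ∀ ε : ℝ, 0 < ε → ∀ τ ∈ subStates c,
        (condForm f v (σ + (ε : ℂ) • kerProj σ)ᵀ τ : EReal) ≤ S := fun ε hε τ hτ =>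
      le_iSup₂_of_le ε hε (le_iSup₂_of_le τ hτ le_rfl)
    clear_value S
    have hbot : S ≠ ⊥ := by
      have h := hle 1 one_pos (smallState c)
        (mem_subStates_iff.mpr ⟨smallState_posDef, smallState_trace.trans (by norm_num)⟩)
      exact ne_bot_of_le_ne_bot (EReal.coe_ne_bot _) h
    rcases eq_or_ne S ⊤ with htop | htop
    · rw [htop]; exact le_top
    lift S to ℝ using ⟨htop, hbot⟩
    set M := condForm f v (smallState b) 1 with hM
    have hlim : Tendsto (fun t : ℝ => (((1 - t) * S + t * M : ℝ) : EReal)) (𝓝[>] 0)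
        (𝓝 ((S : ℝ) : EReal)) := by
      apply (continuous_coe_real_ereal.tendsto _).comp
      have : Tendsto (fun t : ℝ => (1 - t) * S + t * M) (𝓝 0) (𝓝 ((1 - 0) * S + 0 * M)) := by
        apply Continuous.tendsto; fun_prop
      simp only [sub_zero, one_mul, zero_mul, add_zero] at this
      exact this.mono_left nhdsWithin_le_nhds
    refine ge_of_tendsto hlim ?_
    filter_upwards [Ioo_mem_nhdsGT (show (0 : ℝ) < 1 from one_pos)] with t ⟨ht0, ht1⟩
    set k := (kerProj σ).trace.re with hk
    set ε : ℝ := t / (2 * (|k| + 1)) with hε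
    have hεpos : 0 < ε := div_pos ht0 (by positivity)
    have hεk : ε * k ≤ t / 2 := by
      calc ε * k ≤ ε * (|k| + 1) :=
            mul_le_mul_of_nonneg_left ((le_abs_self k).trans (by linarith)) hεpos.le
        _ = t / 2 := by rw [hε]; field_simp
    have hpos := (add_kerProj_posDef hσ.1 hεpos).transpose
    have htr : (σ + (ε : ℂ) • kerProj σ)ᵀ.trace.re ≤ 1 + t / 2 := by
      rw [trace_transpose, trace_add, hσ.2, trace_smul, Complex.add_re, smul_eq_mul,
        Complex.re_ofReal_mul, Complex.one_re]
      linarith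
    have hmem : ((1 - t : ℝ) : ℂ) • (σ + (ε : ℂ) • kerProj σ)ᵀ + (t : ℂ) • smallState b ∈
        subStates b := by
      rw [mem_subStates_iff, trace_comb_re]
      -- The trace is at most `(1 - t) * (1 + t / 2) + t / 2 = 1 - t ^ 2 / 2`.
      refine ⟨posDef_convex_comb hpos smallState_posDef (by linarith) ht0.le (by ring), ?_⟩
      have h1 := mul_le_mul_of_nonneg_left htr (show 0 ≤ 1 - t by linarith)
      have h2 := mul_le_mul_of_nonneg_left (smallState_trace (n := b)) ht0.le
      nlinarith
    refine iInf₂_le_of_le _ hmem (iSup₂_le fun τ hτ => ?_)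
    have h1 : condForm f v (σ + (ε : ℂ) • kerProj σ)ᵀ τ ≤ S := by
      exact_mod_cast hle ε hεpos τ hτ
    refine EReal.coe_le_coe_iff.mpr
      ((condForm_mix_le hf v hpos hτ ht0.le ht1.le).trans ?_)
    exact add_le_add_left (mul_le_mul_of_nonneg_left h1 (by linarith)) _

theorem neg_iSup_eq {ι : Sort*} (u : ι → EReal) : -(⨆ i, u i) = ⨅ i, -u i :=
  EReal.negOrderIso.map_iSup u

theorem neg_iInf_eq {ι : Sort*} (u : ι → EReal) : -(⨅ i, u i) = ⨆ i, -u i :=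
  EReal.negOrderIso.map_iInf u

theorem neg_iSup_iInf_condForm (f : ℝ → ℝ) (v : c × a × b → ℂ) :
    -(⨆ τ ∈ subStates c, ⨅ σ ∈ subStates b, (condForm f v σ τ : EReal)) =
      ⨅ τ ∈ subStates c, ⨆ σ ∈ subStates b, (condForm (dualFun f) (swapVec v) τ σ : EReal) := by
  rw [neg_iSup_eq]
  refine iInf_congr fun τ => ?_
  rw [neg_iSup_eq]
  refine iInf_congr fun hτ => ?_
  rw [neg_iInf_eq]
  refine iSup_congr fun σ => ?_
  rw [neg_iInf_eq]
  refine iSup_congr fun hσ => ?_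
  rw [condForm_swap f v hσ.1 hτ.1, EReal.coe_neg]

theorem condEntropy_conjTranspose_mul_self [Nonempty b] {f : ℝ → ℝ} (hf : OperatorAntiMonotone f)
    (N : Matrix c (a × b) ℂ) :
    condEntropy f (Nᴴ * N) =
      -⨅ σ ∈ subStates b, ⨆ τ ∈ subStates c, (condForm f (toVec N) σ τ : EReal) := by
  rw [condEntropy, ← iInf_density_condForm hf]
  congr 1
  refine iInf_congr fun σ => iInf_congr fun hσ => ?_
  rw [optDiv_eq_iSup]
  refine iSup_congr fun ε => iSup_congr fun hε => ?_
  -- The kernel projection of `I ⊗ σ` is `I` tensor that of `σ`, so the regularization keeps the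
  -- product form.
  have h : ((1 : Matrix a a ℂ) ⊗ₖ σ + (ε : ℂ) • kerProj ((1 : Matrix a a ℂ) ⊗ₖ σ))ᵀ =
      (1 : Matrix a a ℂ) ⊗ₖ (σ + (ε : ℂ) • kerProj σ)ᵀ := by
    rw [kerProj, cfc_one_kronecker _ hσ.1.isHermitian, ← kronecker_smul, ← kronecker_add,
      ← kroneckerMap_transpose, transpose_one]
    rfl
  rw [h]
  exact iSup_divForm_phiVec hf N
    (one_kronecker_posDef (add_kerProj_posDef hσ.1 hε).transpose)

end Duality

end OptFDiv

theorem mainTheorem7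
    {a b c : Type*} [Fintype a] [DecidableEq a] [Fintype b] [DecidableEq b]
    [Fintype c] [DecidableEq c]
    (f : ℝ → ℝ) (hf : OptFDiv.OperatorAntiMonotone f)
    (ψ : EuclideanSpace ℂ (a × b × c)) (hψ : ‖ψ‖ = 1) :
    OptFDiv.condEntropy f (OptFDiv.traceThird (OptFDiv.pureState ψ)) =
      -OptFDiv.condEntropy (fun x : ℝ => -f x⁻¹)
        (OptFDiv.traceSecond (OptFDiv.pureState ψ)) := by
  have hne : Nonempty (a × b × c) := by
    by_contra h
    rw [not_nonempty_iff] at h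
    rw [Subsingleton.elim ψ 0, norm_zero] at hψ
    exact zero_ne_one hψ
  have hb : Nonempty b := hne.map fun p => p.2.1
  have hc : Nonempty c := hne.map fun p => p.2.2
  -- The conjugate makes `Nᴴ * N` equal to the marginal itself rather than its transpose.
  let N : Matrix c (a × b) ℂ := Matrix.of fun k p => star (ψ (p.1, p.2, k))
  let N' : Matrix b (a × c) ℂ := Matrix.of fun j p => star (ψ (p.1, j, p.2))
  have h1 : OptFDiv.traceThird (OptFDiv.pureState ψ) = Nᴴ * N := by
    ext i j
    simp [OptFDiv.traceThird, OptFDiv.pureState, N, Matrix.mul_apply]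
  have h2 : OptFDiv.traceSecond (OptFDiv.pureState ψ) = N'ᴴ * N' := by
    ext i j
    simp [OptFDiv.traceSecond, OptFDiv.pureState, N', Matrix.mul_apply]
  have hvec : OptFDiv.toVec N' = OptFDiv.swapVec (OptFDiv.toVec N) := rfl
  rw [h1, h2, OptFDiv.condEntropy_conjTranspose_mul_self hf]
  change _ = -OptFDiv.condEntropy (OptFDiv.dualFun f) _
  rw [OptFDiv.condEntropy_conjTranspose_mul_self hf.dualFun, hvec, neg_neg,
    OptFDiv.condForm_minimax hf, OptFDiv.neg_iSup_iInf_condForm]
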